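/- All graphs are finite, simple and undirected. For a graph $G$ of order $n$, let $p(G,r)$ be the number of $r$-matchings of $G$, i.e. of sets of $r$ pairwise non-incident edges (so $p(G,0)=1$), and let $$\mu(G,x)=\sum_{r=0}^{\lfloor n/2\rfloor}(-1)^r p(G,r)\,x^{n-2r}$$ be the matching polynomial of $G$. The graph $G$ is called matching integral if all zeros of $\mu(G,x)$ are integers. Let $K_7\setminus(E(C_3)\cup E(C_4))$ denote the graph obtained from the complete graph $K_7$ by deleting the edges of a triangle and the edges of a $4$-cycle on the remaining four vertices. Theorem. Let $k\ge 2$. If $G$ is a matching integral $k$-regular graph, then $G$ is a disjoint union of copies of $K_7\setminus(E(C_3)\cup E(C_4))$. -/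

import Mathlib

namespace SimpleGraph

/-- A finite set `M` of edges of `G` is a matching if its edges are pairwise non-incident,
i.e. no vertex lies on two different edges of `M`. -/
def IsEdgeMatching {V : Type*} (G : SimpleGraph V) (M : Finset (Sym2 V)) : Prop :=
  (∀ e ∈ M, e ∈ G.edgeSet) ∧ ∀ e ∈ M, ∀ f ∈ M, e ≠ f → ∀ v, v ∈ e → v ∉ f

/-- `p(G, r)`: the number of `r`-matchings of `G`. -/
noncomputable def numMatchings {V : Type*} (G : SimpleGraph V) (r : ℕ) : ℕ :=
  {M : Finset (Sym2 V) | G.IsEdgeMatching M ∧ M.card = r}.ncard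

/-- The matching polynomial `μ(G, x) = ∑_{r=0}^{⌊n/2⌋} (-1)^r p(G, r) x^(n - 2 r)`, where `n` is
the order of `G`. -/
noncomputable def matchingPolynomial {V : Type*} [Fintype V] (G : SimpleGraph V) :
    Polynomial ℤ :=
  ∑ r ∈ Finset.range (Fintype.card V / 2 + 1),
    Polynomial.C ((-1) ^ r * (G.numMatchings r : ℤ)) * Polynomial.X ^ (Fintype.card V - 2 * r)

/-- `G` is matching integral if every (complex) zero of its matching polynomial is an integer. -/
def IsMatchingIntegral {V : Type*} [Fintype V] (G : SimpleGraph V) : Prop :=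
  ∀ z : ℂ, Polynomial.aeval z G.matchingPolynomial = 0 → ∃ m : ℤ, z = (m : ℂ)

/-- The graph `K₇ ∖ (E(C₃) ∪ E(C₄))`: the complete graph on seven vertices, with the edges of a
triangle and of a `4`-cycle on the remaining four vertices removed. -/
def K7MinusC3C4 : SimpleGraph (Fin 3 ⊕ Fin 4) :=
  (⊤ : SimpleGraph (Fin 3 ⊕ Fin 4)) \ (cycleGraph 3 ⊕g cycleGraph 4)

/-- The disjoint union of `m` copies of the graph `H`. -/
def disjointCopies {W : Type*} (m : ℕ) (H : SimpleGraph W) : SimpleGraph (Fin m × W) where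
  Adj a b := a.1 = b.1 ∧ H.Adj a.2 b.2
  symm := ⟨fun _ _ h => ⟨h.1.symm, h.2.symm⟩⟩
  loopless := ⟨fun _ h => H.loopless.irrefl _ h.2⟩

end SimpleGraph

/-!
Let `G` be connected, `k`-regular and matching integral, with `n` vertices. Everything about its
matching polynomial `μ(G)` comes from the expansion
`μ(G) = x μ(G - u) - ∑_{v ∼ u} μ(G - u - v)` (`matchPolyOn_expand`), which is why the polynomial is
carried along for all vertex sets of `G` at once (`matchPolyOn`).

Two facts bound the number of distinct zeros. From above, the zeros satisfy `z² < 4(k - 1)`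
(Heilmann–Lieb, `sq_lt_of_aeval_matchPolyOn_eq_zero`), so being integers they are few. From below,
if `P` is a path then a zero of `μ(G)` of multiplicity `m` is a zero of `μ(G - P)` of multiplicity
at least `m - 1` (Godsil), so there are at least `|P|` distinct zeros (`length_le_card_roots`).
The multiplicity bound follows from the estimate `|μ(G - P)| ≤ |μ(G)| / Im z` in the upper half
plane, a consequence of the Ward identity for the quotients `μ(G - u) / μ(G)`. By Dirac's theorem
(`exists_path_min_card_le_length`) there is a path with at least `min n (2k + 1)` vertices. Since
`2k + 1` integers cannot all have square less than `4(k - 1)`, this path is Hamiltonian, all zeros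
are simple and `n ≤ 2k`; then `k + 1 ≤ n` forces `k ≤ 14`.

The zeros are now a symmetric set of `n` integers whose squares add up to `nk`, twice the number of
edges. A finite enumeration (`zeros_enumeration`) leaves `k = 4`, `n = 7` and the complete graphs on
`5`, `7` and `11` vertices, always with `1` among the zeros. Hermite polynomials of these degrees do
not vanish at `1`. A `4`-regular graph on seven vertices is the complement of `C₇` or of `C₃ ∪ C₄`,
and the matching polynomial of the former does not vanish at `1` either.

For disconnected `G`, the polynomial of a component divides `μ(G)` (`matchPolyOn_union`), so every
component is matching integral.
-/

/-! ### Matching polynomials of induced subgraphs and their vertex expansion -/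

namespace SimpleGraph

open Polynomial
open scoped Classical

/-- The vertices of `S` that lie on no edge of `M`. -/
noncomputable def uncovered {V : Type*} (S : Finset V) (M : Finset (Sym2 V)) : Finset V :=
  S.filter fun v => ∀ e ∈ M, v ∉ e

/-- The matchings of `G` all of whose edges lie inside the vertex set `S`. -/
noncomputable def matchingsIn {V : Type*} [Fintype V] (G : SimpleGraph V) (S : Finset V) :
    Finset (Finset (Sym2 V)) :=
  Finset.univ.filter fun M => G.IsEdgeMatching M ∧ ∀ e ∈ M, ∀ v ∈ e, v ∈ S

/-- The matching polynomial of the subgraph of `G` induced on `S`. The exponent of `X` is recorded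
as the number of vertices of `S` missed by the matching, which avoids truncated subtraction. -/
noncomputable def matchPolyOn {V : Type*} [Fintype V] (G : SimpleGraph V) (S : Finset V) : ℤ[X] :=
  ∑ M ∈ G.matchingsIn S, (-1) ^ M.card * X ^ (uncovered S M).card

variable {V : Type*}

theorem mem_uncovered {S : Finset V} {M : Finset (Sym2 V)} {v : V} :
    v ∈ uncovered S M ↔ v ∈ S ∧ ∀ e ∈ M, v ∉ e := by
  simp [uncovered]

theorem mem_matchingsIn [Fintype V] {G : SimpleGraph V} {S : Finset V} {M : Finset (Sym2 V)} :
    M ∈ G.matchingsIn S ↔ G.IsEdgeMatching M ∧ ∀ e ∈ M, ∀ v ∈ e, v ∈ S := by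
  simp [matchingsIn]

theorem matchPolyOn_empty [Fintype V] (G : SimpleGraph V) : G.matchPolyOn ∅ = 1 := by
  have : G.matchingsIn ∅ = {∅} := by
    ext M
    rw [mem_matchingsIn, Finset.mem_singleton]
    constructor
    · rintro ⟨-, h⟩
      refine Finset.eq_empty_of_forall_notMem fun e he => ?_
      induction e with | _ a b
      simpa using h _ he a (by simp)
    · rintro rfl
      simp [IsEdgeMatching]
  simp [matchPolyOn, this, uncovered]

theorem matchingsIn_filter_missing [Fintype V] (G : SimpleGraph V) (S : Finset V) (u : V) :
    (G.matchingsIn S).filter (fun M => ∀ e ∈ M, u ∉ e) = G.matchingsIn (S.erase u) := by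
  ext M
  simp only [Finset.mem_filter, mem_matchingsIn, Finset.mem_erase]
  constructor
  · rintro ⟨⟨h1, h2⟩, h3⟩
    exact ⟨h1, fun e he v hv => ⟨fun h => h3 e he (h ▸ hv), h2 e he v hv⟩⟩
  · rintro ⟨h1, h2⟩
    exact ⟨⟨h1, fun e he v hv => (h2 e he v hv).2⟩, fun e he hu => (h2 e he u hu).1 rfl⟩

theorem matchingsIn_filter_covering [Fintype V] (G : SimpleGraph V) {S : Finset V} (u : V) :
    (G.matchingsIn S).filter (fun M => ¬ ∀ e ∈ M, u ∉ e) =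
      (S.filter (G.Adj u)).biUnion fun v => (G.matchingsIn S).filter (s(u, v) ∈ ·) := by
  ext M
  simp only [Finset.mem_filter, Finset.mem_biUnion, not_forall, not_not]
  constructor
  · rintro ⟨hM, e, he, hu⟩
    obtain ⟨v, rfl⟩ := hu
    have hM' := mem_matchingsIn.1 hM
    exact ⟨v, ⟨hM'.2 _ he v (by simp), hM'.1.1 _ he⟩, hM, he⟩
  · rintro ⟨v, -, hM, he⟩
    exact ⟨hM, _, he, by simp⟩

theorem sum_matchingsIn_edge [Fintype V] (G : SimpleGraph V) {S : Finset V} {u v : V}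
    (hu : u ∈ S) (hv : v ∈ S) (huv : G.Adj u v) :
    ∑ M ∈ (G.matchingsIn S).filter (s(u, v) ∈ ·),
      ((-1) ^ M.card * X ^ (uncovered S M).card : ℤ[X]) =
    - G.matchPolyOn ((S.erase u).erase v) := by
  rw [matchPolyOn, ← Finset.sum_neg_distrib]
  refine Finset.sum_bij' (fun M _ => M.erase s(u, v)) (fun M _ => insert s(u, v) M) ?_ ?_ ?_ ?_ ?_
  · intro M hM
    obtain ⟨hM, he⟩ := Finset.mem_filter.1 hM
    obtain ⟨⟨h1, h2⟩, h3⟩ := mem_matchingsIn.1 hM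
    refine mem_matchingsIn.2 ⟨⟨fun e he => h1 e (Finset.mem_of_mem_erase he), fun e he f hf =>
      h2 e (Finset.mem_of_mem_erase he) f (Finset.mem_of_mem_erase hf)⟩, fun e hee w hw => ?_⟩
    obtain ⟨hne, heM⟩ := Finset.mem_erase.1 hee
    have := h2 e heM _ he hne w hw
    simp only [Sym2.mem_iff, not_or] at this
    exact Finset.mem_erase.2 ⟨this.2, Finset.mem_erase.2 ⟨this.1, h3 e heM w hw⟩⟩
  · intro M hM
    obtain ⟨⟨h1, h2⟩, h3⟩ := mem_matchingsIn.1 hM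
    have key : ∀ e ∈ M, ∀ w ∈ e, w ∉ s(u, v) := by
      intro e he w hw
      have := h3 e he w hw
      simp only [Finset.mem_erase] at this
      simp [this.1, this.2.1]
    refine Finset.mem_filter.2 ⟨mem_matchingsIn.2 ⟨⟨?_, ?_⟩, ?_⟩, Finset.mem_insert_self _ _⟩
    · intro e he
      rcases Finset.mem_insert.1 he with rfl | he
      · exact huv
      · exact h1 e he
    · intro e he f hf hef w hw
      rcases Finset.mem_insert.1 he with rfl | he <;> rcases Finset.mem_insert.1 hf with rfl | hf
      · exact absurd rfl hef
      · exact fun hw' => key f hf w hw' hw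
      · exact key e he w hw
      · exact h2 e he f hf hef w hw
    · intro e he w hw
      rcases Finset.mem_insert.1 he with rfl | he
      · rcases Sym2.mem_iff.1 hw with rfl | rfl <;> assumption
      · exact Finset.mem_of_mem_erase (Finset.mem_of_mem_erase (h3 e he w hw))
  · intro M hM
    exact Finset.insert_erase (Finset.mem_filter.1 hM).2
  · intro M hM
    refine Finset.erase_insert fun he => ?_
    simpa using (mem_matchingsIn.1 hM).2 _ he u (by simp)
  · intro M hM
    obtain ⟨hM, he⟩ := Finset.mem_filter.1 hM
    obtain ⟨⟨h1, h2⟩, h3⟩ := mem_matchingsIn.1 hM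
    have hc : M.card = (M.erase s(u, v)).card + 1 := (Finset.card_erase_add_one he).symm
    have hun : uncovered S M = uncovered ((S.erase u).erase v) (M.erase s(u, v)) := by
      ext w
      simp only [mem_uncovered, Finset.mem_erase]
      constructor
      · rintro ⟨hw, h⟩
        have := h _ he
        simp only [Sym2.mem_iff, not_or] at this
        exact ⟨⟨this.2, this.1, hw⟩, fun e he => h e he.2⟩
      · rintro ⟨⟨hwv, hwu, hw⟩, h⟩
        refine ⟨hw, fun e heM => ?_⟩
        by_cases hee : e = s(u, v)
        · simp [hee, hwv, hwu]
        · exact h e ⟨hee, heM⟩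
    rw [hc, hun]
    ring

/-- Expansion of the matching polynomial along a vertex: a matching either misses `u` or contains
exactly one edge at `u`. -/
theorem matchPolyOn_expand [Fintype V] (G : SimpleGraph V) {S : Finset V} {u : V} (hu : u ∈ S) :
    G.matchPolyOn S = X * G.matchPolyOn (S.erase u) -
      ∑ v ∈ S.filter (G.Adj u), G.matchPolyOn ((S.erase u).erase v) := by
  rw [matchPolyOn, ← Finset.sum_filter_add_sum_filter_not _ (fun M => ∀ e ∈ M, u ∉ e),
    matchingsIn_filter_missing, matchingsIn_filter_covering, Finset.sum_biUnion, sub_eq_add_neg,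
    ← Finset.sum_neg_distrib]
  · congr 1
    · rw [matchPolyOn, Finset.mul_sum]
      refine Finset.sum_congr rfl fun M hM => ?_
      have : uncovered S M = insert u (uncovered (S.erase u) M) := by
        ext w
        simp only [mem_uncovered, Finset.mem_erase, Finset.mem_insert]
        by_cases hw : w = u
        · subst hw
          have : ∀ e ∈ M, w ∉ e := fun e he h => by
            simpa using (mem_matchingsIn.1 hM).2 e he w h
          simp only [hu, true_and, true_or, iff_true]
          exact this
        · simp [hw]
      rw [this, Finset.card_insert_of_notMem (by simp [mem_uncovered])]
      ring
    · refine Finset.sum_congr rfl fun v hv => ?_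
      obtain ⟨hv, huv⟩ := Finset.mem_filter.1 hv
      exact sum_matchingsIn_edge G hu hv huv
  · intro v hv w hw hvw
    refine Finset.disjoint_left.2 fun M hM hM' => ?_
    obtain ⟨hM, he⟩ := Finset.mem_filter.1 hM
    obtain ⟨-, hf⟩ := Finset.mem_filter.1 hM'
    refine (mem_matchingsIn.1 hM).1.2 _ he _ hf (fun h => hvw (Sym2.congr_right.1 h)) u (by simp)
      (by simp)

theorem IsEdgeMatching.card_uncovered_univ [Fintype V] {G : SimpleGraph V} {M : Finset (Sym2 V)}
    (hM : G.IsEdgeMatching M) :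
    (uncovered Finset.univ M).card + 2 * M.card = Fintype.card V := by
  have h1 : (M.biUnion Sym2.toFinset).card = 2 * M.card := by
    rw [Finset.card_biUnion, Finset.sum_congr rfl (g := fun _ => 2), Finset.sum_const, smul_eq_mul,
      mul_comm]
    · intro e he
      exact Sym2.card_toFinset_of_not_isDiag e (G.not_isDiag_of_mem_edgeSet (hM.1 e he))
    · intro e he f hf hef
      refine Finset.disjoint_left.2 fun v hv hv' => ?_
      exact hM.2 e he f hf hef v (Sym2.mem_toFinset.1 hv) (Sym2.mem_toFinset.1 hv')
  have h2 : uncovered Finset.univ M = (M.biUnion Sym2.toFinset)ᶜ := by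
    ext v
    simp [mem_uncovered]
  rw [h2, ← h1]
  exact Finset.card_compl_add_card _

theorem matchingPolynomial_eq_matchPolyOn_univ [Fintype V] (G : SimpleGraph V) :
    G.matchingPolynomial = G.matchPolyOn Finset.univ := by
  have hmap : ∀ M ∈ G.matchingsIn Finset.univ,
      M.card ∈ Finset.range (Fintype.card V / 2 + 1) := by
    intro M hM
    have := (mem_matchingsIn.1 hM).1.card_uncovered_univ
    rw [Finset.mem_range]
    omega
  rw [matchPolyOn, ← Finset.sum_fiberwise_of_maps_to hmap, matchingPolynomial]
  refine Finset.sum_congr rfl fun r hr => ?_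
  have hn : G.numMatchings r = ((G.matchingsIn Finset.univ).filter (·.card = r)).card := by
    rw [numMatchings, ← Set.ncard_coe_finset]
    congr 1
    ext M
    simp [mem_matchingsIn]
  rw [hn, Finset.sum_congr rfl (g := fun _ => (-1) ^ r * X ^ (Fintype.card V - 2 * r))]
  · rw [Finset.sum_const, nsmul_eq_mul]
    simp only [map_mul, map_pow, map_neg, map_one, map_natCast]
    ring
  · intro M hM
    obtain ⟨hM', rfl⟩ := Finset.mem_filter.1 hM
    have := (mem_matchingsIn.1 hM').1.card_uncovered_univ
    rw [← this, Nat.add_sub_cancel]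

end SimpleGraph

/-! ### Products, parity, complete graphs and the Heilmann–Lieb bound -/

namespace SimpleGraph

open Polynomial
open scoped Classical

variable {V : Type*}

theorem aeval_matchPolyOn_expand [Fintype V] (G : SimpleGraph V) {A : Type*} [CommRing A] (x : A)
    {S : Finset V} {u : V} (hu : u ∈ S) :
    aeval x (G.matchPolyOn S) = x * aeval x (G.matchPolyOn (S.erase u)) -
      ∑ v ∈ S.filter (G.Adj u), aeval x (G.matchPolyOn ((S.erase u).erase v)) := by
  rw [matchPolyOn_expand G hu]
  simp

theorem matchPolyOn_map {W : Type*} [Fintype V] [Fintype W] {H : SimpleGraph W}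
    {G : SimpleGraph V} (f : H ↪g G) (S : Finset W) :
    G.matchPolyOn (S.map f.toEmbedding) = H.matchPolyOn S := by
  induction S using Finset.strongInduction with | _ S ih
  rcases S.eq_empty_or_nonempty with rfl | ⟨u, hu⟩
  · simp [matchPolyOn_empty]
  · rw [matchPolyOn_expand H hu, matchPolyOn_expand G (Finset.mem_map_of_mem _ hu),
      ← Finset.map_erase, ih _ (Finset.erase_ssubset hu), Finset.filter_map, Finset.sum_map]
    congr 1
    refine Finset.sum_congr ?_ fun v hv => ?_
    · ext v
      simp
    · rw [← Finset.map_erase]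
      exact ih _ ((Finset.erase_subset _ _).trans_ssubset (Finset.erase_ssubset hu))

theorem matchPolyOn_union [Fintype V] (G : SimpleGraph V) {S T : Finset V} (hST : Disjoint S T)
    (hadj : ∀ u ∈ S, ∀ v ∈ T, ¬ G.Adj u v) :
    G.matchPolyOn (S ∪ T) = G.matchPolyOn S * G.matchPolyOn T := by
  induction S using Finset.strongInduction with | _ S ih
  rcases S.eq_empty_or_nonempty with rfl | ⟨u, hu⟩
  · simp [matchPolyOn_empty]
  · have key : ∀ S' ⊂ S, G.matchPolyOn (S' ∪ T) = G.matchPolyOn S' * G.matchPolyOn T :=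
      fun S' hS' => ih S' hS' (hST.mono_left hS'.subset) fun a ha => hadj a (hS'.subset ha)
    have hT : ∀ w ∈ S, T.erase w = T := fun w hw =>
      Finset.erase_eq_of_notMem (Finset.disjoint_left.1 hST hw)
    have hfil : (S ∪ T).filter (G.Adj u) = S.filter (G.Adj u) := by
      rw [Finset.filter_union, Finset.filter_eq_empty_iff.2 (hadj u hu), Finset.union_empty]
    rw [matchPolyOn_expand G (Finset.mem_union_left _ hu), matchPolyOn_expand G hu, hfil,
      Finset.erase_union_distrib, hT u hu, key _ (Finset.erase_ssubset hu), sub_mul,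
      Finset.sum_mul, mul_assoc]
    congr 1
    refine Finset.sum_congr rfl fun v hv => ?_
    rw [Finset.erase_union_distrib, hT v (Finset.mem_filter.1 hv).1]
    exact key _ ((Finset.erase_subset _ _).trans_ssubset (Finset.erase_ssubset hu))

theorem monic_natDegree_matchPolyOn [Fintype V] (G : SimpleGraph V) (S : Finset V) :
    (G.matchPolyOn S).Monic ∧ (G.matchPolyOn S).natDegree = S.card := by
  induction S using Finset.strongInduction with | _ S ih
  rcases S.eq_empty_or_nonempty with rfl | ⟨u, hu⟩
  · simp [matchPolyOn_empty]
  · obtain ⟨h1, h2⟩ := ih _ (Finset.erase_ssubset hu)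
    have h3 : (X * G.matchPolyOn (S.erase u)).Monic := monic_X.mul h1
    have h4 : (X * G.matchPolyOn (S.erase u)).degree = (S.card : WithBot ℕ) := by
      rw [degree_eq_natDegree h3.ne_zero, monic_X.natDegree_mul h1, natDegree_X, h2, add_comm,
        Finset.card_erase_add_one hu]
    have h5 : (∑ v ∈ S.filter (G.Adj u), G.matchPolyOn ((S.erase u).erase v)).degree <
        (X * G.matchPolyOn (S.erase u)).degree := by
      rw [h4]
      refine (degree_sum_le _ _).trans_lt ((Finset.sup_lt_iff (WithBot.bot_lt_coe _)).2
        fun v hv => ?_)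
      have hss : (S.erase u).erase v ⊂ S :=
        (Finset.erase_subset _ _).trans_ssubset (Finset.erase_ssubset hu)
      rw [degree_eq_natDegree (ih _ hss).1.ne_zero, (ih _ hss).2]
      exact_mod_cast Finset.card_lt_card hss
    rw [matchPolyOn_expand G hu]
    refine ⟨h3.sub_of_left h5, ?_⟩
    rw [natDegree, degree_sub_eq_left_of_degree_lt h5, h4]
    rfl

theorem monic_matchPolyOn [Fintype V] (G : SimpleGraph V) (S : Finset V) :
    (G.matchPolyOn S).Monic :=
  (G.monic_natDegree_matchPolyOn S).1

theorem natDegree_matchPolyOn [Fintype V] (G : SimpleGraph V) (S : Finset V) :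
    (G.matchPolyOn S).natDegree = S.card :=
  (G.monic_natDegree_matchPolyOn S).2

theorem aeval_neg_matchPolyOn [Fintype V] (G : SimpleGraph V) {A : Type*} [CommRing A] (x : A)
    (S : Finset V) :
    aeval (-x) (G.matchPolyOn S) = (-1) ^ S.card * aeval x (G.matchPolyOn S) := by
  induction S using Finset.strongInduction with | _ S ih
  rcases S.eq_empty_or_nonempty with rfl | ⟨u, hu⟩
  · simp [matchPolyOn_empty]
  · have hc := Finset.card_erase_add_one hu
    rw [aeval_matchPolyOn_expand G _ hu, aeval_matchPolyOn_expand G _ hu,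
      ih _ (Finset.erase_ssubset hu), mul_sub, Finset.mul_sum, ← hc]
    congr 1
    · ring
    · refine Finset.sum_congr rfl fun v hv => ?_
      obtain ⟨hv, huv⟩ := Finset.mem_filter.1 hv
      have hv' : v ∈ S.erase u := Finset.mem_erase.2 ⟨huv.ne', hv⟩
      rw [ih _ ((Finset.erase_subset _ _).trans_ssubset (Finset.erase_ssubset hu)),
        ← Finset.card_erase_add_one hv']
      ring

/-- The value at `1` of the matching polynomial of the complete graph on `n` vertices, i.e. of the
`n`-th (probabilists') Hermite polynomial. -/
def hermiteAtOne : ℕ → ℤ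
  | 0 => 1
  | 1 => 1
  | n + 2 => hermiteAtOne (n + 1) - (n + 1) * hermiteAtOne n

theorem aeval_one_matchPolyOn_of_complete [Fintype V] (G : SimpleGraph V)
    (hG : ∀ u v, u ≠ v → G.Adj u v) (S : Finset V) :
    aeval (1 : ℤ) (G.matchPolyOn S) = hermiteAtOne S.card := by
  induction S using Finset.strongInduction with | _ S ih
  rcases S.eq_empty_or_nonempty with rfl | ⟨u, hu⟩
  · simp [matchPolyOn_empty, hermiteAtOne]
  · have hc := Finset.card_erase_add_one hu
    have hfil : S.filter (G.Adj u) = S.erase u := by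
      ext v
      simp only [Finset.mem_filter, Finset.mem_erase]
      exact ⟨fun h => ⟨h.2.ne', h.1⟩, fun h => ⟨h.2, hG u v h.1.symm⟩⟩
    have hsum : ∀ v ∈ S.erase u,
        aeval (1 : ℤ) (G.matchPolyOn ((S.erase u).erase v)) =
          hermiteAtOne ((S.erase u).card - 1) := fun v hv => by
      rw [ih _ ((Finset.erase_subset _ _).trans_ssubset (Finset.erase_ssubset hu)),
        Finset.card_erase_of_mem hv]
    rw [aeval_matchPolyOn_expand _ _ hu, hfil, Finset.sum_congr rfl hsum,
      ih _ (Finset.erase_ssubset hu), ← hc, Finset.sum_const, nsmul_eq_mul]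
    rcases (S.erase u).card with _ | n
    · simp [hermiteAtOne]
    · simp [hermiteAtOne]

/-- The Heilmann–Lieb bound, in the form used for its induction: for `x ≥ 2√(k-1)` the matching
polynomial is positive at `x`, and deleting a vertex of degree at most `k - 1` divides its value by
more than `√(k-1)`. -/
theorem matchPolyOn_pos_aux [Fintype V] (G : SimpleGraph V) {k : ℕ} (hk : 2 ≤ k)
    (hdeg : ∀ u, (Finset.univ.filter (G.Adj u)).card ≤ k) {q x : ℝ} (hq : 0 < q)
    (hq2 : q ^ 2 = k - 1) (hx : 2 * q ≤ x) (S : Finset V) :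
    0 < aeval x (G.matchPolyOn S) ∧ ∀ u ∈ S, (S.filter (G.Adj u)).card + 1 ≤ k →
      q * aeval x (G.matchPolyOn (S.erase u)) < aeval x (G.matchPolyOn S) := by
  have hk' : (2 : ℝ) ≤ k := by exact_mod_cast hk
  induction S using Finset.strongInduction with | _ S ih
  -- A neighbour of `u` has degree at most `k - 1` once `u` is deleted, so induction applies to it.
  have step : ∀ u ∈ S,
      q * ∑ v ∈ S.filter (G.Adj u), aeval x (G.matchPolyOn ((S.erase u).erase v)) ≤
        (S.filter (G.Adj u)).card * aeval x (G.matchPolyOn (S.erase u)) ∧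
      ((S.filter (G.Adj u)).Nonempty →
      q * ∑ v ∈ S.filter (G.Adj u), aeval x (G.matchPolyOn ((S.erase u).erase v)) <
        (S.filter (G.Adj u)).card * aeval x (G.matchPolyOn (S.erase u))) := by
    intro u hu
    have hlt : ∀ v ∈ S.filter (G.Adj u),
        q * aeval x (G.matchPolyOn ((S.erase u).erase v)) <
          aeval x (G.matchPolyOn (S.erase u)) := by
      intro v hv
      obtain ⟨hv, huv⟩ := Finset.mem_filter.1 hv
      refine (ih _ (Finset.erase_ssubset hu)).2 v (Finset.mem_erase.2 ⟨huv.ne', hv⟩) ?_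
      refine (Nat.lt_iff_add_one_le.1 (Finset.card_lt_card ?_)).trans (hdeg v)
      refine Finset.ssubset_iff_of_subset (fun w hw => ?_) |>.2 ⟨u, ?_, ?_⟩
      · simp [(Finset.mem_filter.1 hw).2]
      · simp [huv.symm]
      · simp
    rw [Finset.mul_sum, ← nsmul_eq_mul, ← Finset.sum_const]
    exact ⟨Finset.sum_le_sum fun v hv => (hlt v hv).le,
      fun hne => Finset.sum_lt_sum_of_nonempty hne hlt⟩
  constructor
  · rcases S.eq_empty_or_nonempty with rfl | ⟨u, hu⟩
    · simp [matchPolyOn_empty]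
    · have hpos := (ih _ (Finset.erase_ssubset hu)).1
      rw [aeval_matchPolyOn_expand G x hu]
      set Y := aeval x (G.matchPolyOn (S.erase u))
      set Z := ∑ v ∈ S.filter (G.Adj u), aeval x (G.matchPolyOn ((S.erase u).erase v))
      obtain ⟨h1, h2⟩ := step u hu
      have hd : ((S.filter (G.Adj u)).card : ℝ) ≤ k := by
        exact_mod_cast (Finset.card_le_card (Finset.filter_subset_filter _
          (Finset.subset_univ S))).trans (hdeg u)
      have h3 : 2 * q ^ 2 * Y ≤ q * (x * Y) := by nlinarith [mul_pos hq hpos]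
      have h4 : q * Z < 2 * q ^ 2 * Y := by
        rcases (S.filter (G.Adj u)).eq_empty_or_nonempty with he | hne
        · have : Z = 0 := by simp [Z, he]
          rw [this]
          simp only [mul_zero]
          positivity
        · have := h2 hne
          rw [hq2]
          nlinarith
      have : 0 < q * (x * Y - Z) := by linarith
      exact pos_of_mul_pos_right this hq.le
  · intro u hu hd
    have hpos := (ih _ (Finset.erase_ssubset hu)).1
    rw [aeval_matchPolyOn_expand G x hu]
    obtain ⟨h1, h2⟩ := step u hu
    set Y := aeval x (G.matchPolyOn (S.erase u))
    set Z := ∑ v ∈ S.filter (G.Adj u), aeval x (G.matchPolyOn ((S.erase u).erase v))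
    have hd' : ((S.filter (G.Adj u)).card : ℝ) + 1 ≤ k := by exact_mod_cast hd
    have h3 : 2 * q ^ 2 * Y ≤ q * (x * Y) := by nlinarith [mul_pos hq hpos]
    have h4 : q * Z < q ^ 2 * Y := by
      rcases (S.filter (G.Adj u)).eq_empty_or_nonempty with he | hne
      · have : Z = 0 := by simp [Z, he]
        rw [this]
        simp only [mul_zero]
        positivity
      · have := h2 hne
        rw [hq2]
        nlinarith
    have : 0 < q * (x * Y - Z - q * Y) := by nlinarith
    linarith [pos_of_mul_pos_right this hq.le]

/-- The Heilmann–Lieb bound for integer zeros: they satisfy `|m| < 2√(k-1)`. -/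
theorem sq_lt_of_aeval_matchPolyOn_eq_zero [Fintype V] (G : SimpleGraph V) {k : ℕ} (hk : 2 ≤ k)
    (hdeg : ∀ u, (Finset.univ.filter (G.Adj u)).card ≤ k) {S : Finset V} {m : ℤ}
    (hm : aeval m (G.matchPolyOn S) = 0) : m ^ 2 < 4 * ((k : ℤ) - 1) := by
  wlog hm0 : 0 ≤ m generalizing m
  · have := this (m := -m) (by rw [aeval_neg_matchPolyOn, hm, mul_zero]) (by omega)
    simpa using this
  by_contra! hcon
  have hk' : (2 : ℝ) ≤ k := by exact_mod_cast hk
  have hcon' : 4 * ((k : ℝ) - 1) ≤ (m : ℝ) ^ 2 := by exact_mod_cast hcon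
  have hq2 : Real.sqrt ((k : ℝ) - 1) ^ 2 = k - 1 := Real.sq_sqrt (by linarith)
  have hq : 0 < Real.sqrt ((k : ℝ) - 1) := Real.sqrt_pos.2 (by linarith)
  have hm0' : (0 : ℝ) ≤ m := by exact_mod_cast hm0
  have := (G.matchPolyOn_pos_aux hk hdeg hq hq2 (x := (m : ℝ))
    (abs_le_of_sq_le_sq' (by nlinarith) hm0').2 S).1
  have h0 : aeval (m : ℝ) (G.matchPolyOn S) = ((aeval m (G.matchPolyOn S) : ℤ) : ℝ) := by
    simpa using aeval_algebraMap_apply ℝ m (G.matchPolyOn S)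
  rw [h0, hm] at this
  simp at this

end SimpleGraph

/-! ### Deleting a path lowers multiplicities by at most one -/

namespace SimpleGraph

open Polynomial
open scoped Classical

variable {V : Type*}

theorem matchPolyOn_div_eq [Fintype V] (G : SimpleGraph V) (z : ℂ) {S : Finset V} {u : V}
    (hu : u ∈ S) (h0 : aeval z (G.matchPolyOn (S.erase u)) ≠ 0) :
    aeval z (G.matchPolyOn S) / aeval z (G.matchPolyOn (S.erase u)) =
      z - ∑ v ∈ S.filter (G.Adj u),
        aeval z (G.matchPolyOn ((S.erase u).erase v)) / aeval z (G.matchPolyOn (S.erase u)) := by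
  rw [aeval_matchPolyOn_expand G z hu, sub_div, mul_div_assoc, div_self h0, mul_one,
    Finset.sum_div]

/-- In the upper half plane the quotients `μ(G)/μ(G - u)` have imaginary part at least that of the
argument; in particular matching polynomials have no zeros there. -/
theorem im_le_im_matchPolyOn_div [Fintype V] (G : SimpleGraph V) {z : ℂ} (hz : 0 < z.im)
    (S : Finset V) : aeval z (G.matchPolyOn S) ≠ 0 ∧ ∀ u ∈ S,
      z.im ≤ (aeval z (G.matchPolyOn S) / aeval z (G.matchPolyOn (S.erase u))).im := by
  induction S using Finset.strongInduction with | _ S ih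
  have key : ∀ u ∈ S,
      z.im ≤ (aeval z (G.matchPolyOn S) / aeval z (G.matchPolyOn (S.erase u))).im := by
    intro u hu
    obtain ⟨h0, h1⟩ := ih _ (Finset.erase_ssubset hu)
    rw [matchPolyOn_div_eq G z hu h0, Complex.sub_im, Complex.im_sum]
    have : ∑ v ∈ S.filter (G.Adj u), (aeval z (G.matchPolyOn ((S.erase u).erase v)) /
        aeval z (G.matchPolyOn (S.erase u))).im ≤ 0 := by
      refine Finset.sum_nonpos fun v hv => ?_
      obtain ⟨hv, huv⟩ := Finset.mem_filter.1 hv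
      have := h1 v (Finset.mem_erase.2 ⟨huv.ne', hv⟩)
      rw [← inv_div, Complex.inv_im]
      exact div_nonpos_of_nonpos_of_nonneg (by linarith) (Complex.normSq_nonneg _)
    linarith
  refine ⟨?_, key⟩
  rcases S.eq_empty_or_nonempty with rfl | ⟨u, hu⟩
  · simp [matchPolyOn_empty]
  · intro h
    have := key u hu
    rw [h, zero_div, Complex.zero_im] at this
    linarith

/-- The Ward identity for the quotients `r(S, u) = μ(S - u)/μ(S)`: one has
`-Im r(S, u) = |r(S, u)|² (Im z + ∑ -Im r(S - u, v))`, the sum over the neighbours `v` of `u`. -/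
theorem neg_im_matchPolyOn_div_eq [Fintype V] (G : SimpleGraph V) {z : ℂ} (hz : 0 < z.im)
    {S : Finset V} {u : V} (hu : u ∈ S) :
    -(aeval z (G.matchPolyOn (S.erase u)) / aeval z (G.matchPolyOn S)).im =
      ‖aeval z (G.matchPolyOn (S.erase u)) / aeval z (G.matchPolyOn S)‖ ^ 2 *
        (z.im + ∑ v ∈ S.filter (G.Adj u), -(aeval z (G.matchPolyOn ((S.erase u).erase v)) /
          aeval z (G.matchPolyOn (S.erase u))).im) := by
  have h0 := (G.im_le_im_matchPolyOn_div hz (S.erase u)).1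
  have h : z.im + ∑ v ∈ S.filter (G.Adj u), -(aeval z (G.matchPolyOn ((S.erase u).erase v)) /
      aeval z (G.matchPolyOn (S.erase u))).im =
      (aeval z (G.matchPolyOn S) / aeval z (G.matchPolyOn (S.erase u))).im := by
    rw [matchPolyOn_div_eq G z hu h0, Complex.sub_im, Complex.im_sum, Finset.sum_neg_distrib]
    ring
  rw [h, ← inv_div, Complex.inv_im, norm_inv, inv_pow, ← Complex.normSq_eq_norm_sq]
  ring

/-- Deleting a path changes the matching polynomial by a factor of at most `1 / Im z`. The quotient
`μ(G - P)/μ(G)` is an entry of the resolvent of the path tree, but the Ward identity alone bounds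
it. -/
theorem im_mul_norm_matchPolyOn_sdiff_le [Fintype V] (G : SimpleGraph V) {z : ℂ} (hz : 0 < z.im)
    {S : Finset V} {P : List V} (hP : P.IsChain G.Adj) (hnd : P.Nodup) (hPS : ∀ v ∈ P, v ∈ S)
    (hne : P ≠ []) :
    z.im * ‖aeval z (G.matchPolyOn (S \ P.toFinset))‖ ≤ ‖aeval z (G.matchPolyOn S)‖ := by
  have hnonneg : ∀ (S : Finset V), ∀ u ∈ S,
      0 ≤ -(aeval z (G.matchPolyOn (S.erase u)) / aeval z (G.matchPolyOn S)).im := by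
    intro S u hu
    have := (G.im_le_im_matchPolyOn_div hz S).2 u hu
    rw [← inv_div, Complex.inv_im, neg_div, neg_neg]
    exact div_nonneg (by linarith) (Complex.normSq_nonneg _)
  -- Along the path, the Ward identity is used only through one term of its right-hand side.
  have main : ∀ (L : List V) (S : Finset V) (u : V), (u :: L).IsChain G.Adj → (u :: L).Nodup →
      (∀ v ∈ u :: L, v ∈ S) →
      ‖aeval z (G.matchPolyOn (S \ (u :: L).toFinset))‖ ^ 2 * z.im ≤
        ‖aeval z (G.matchPolyOn S)‖ ^ 2 *
          -(aeval z (G.matchPolyOn (S.erase u)) / aeval z (G.matchPolyOn S)).im := by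
    intro L
    induction L with
    | nil =>
      intro S u _ _ hS
      have hu : u ∈ S := hS u (by simp)
      have h0 := (G.im_le_im_matchPolyOn_div hz S).1
      rw [neg_im_matchPolyOn_div_eq G hz hu, norm_div, div_pow, ← mul_assoc,
        mul_div_cancel₀ _ (pow_ne_zero 2 (norm_ne_zero_iff.2 h0))]
      have : S \ [u].toFinset = S.erase u := by
        ext
        simp [and_comm]
      rw [this]
      refine mul_le_mul_of_nonneg_left ?_ (by positivity)
      refine le_add_of_nonneg_right (Finset.sum_nonneg fun v hv => ?_)
      obtain ⟨hv, huv⟩ := Finset.mem_filter.1 hv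
      exact hnonneg _ v (Finset.mem_erase.2 ⟨huv.ne', hv⟩)
    | cons v L ihL =>
      intro S u hch hnd hS
      have hu : u ∈ S := hS u (by simp)
      have h0 := (G.im_le_im_matchPolyOn_div hz S).1
      rw [List.isChain_cons_cons] at hch
      have hnd' := List.nodup_cons.1 hnd
      have hv : v ∈ S.filter (G.Adj u) := by simp [hch.1, hS v]
      have hS' : ∀ w ∈ v :: L, w ∈ S.erase u := fun w hw =>
        Finset.mem_erase.2 ⟨fun h => hnd'.1 (h ▸ hw), hS w (List.mem_cons_of_mem _ hw)⟩
      have h1 := ihL (S.erase u) v hch.2 hnd'.2 hS'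
      have hsd : S \ (u :: v :: L).toFinset = S.erase u \ (v :: L).toFinset := by
        ext
        simp only [List.toFinset_cons, Finset.mem_sdiff, Finset.mem_insert, Finset.mem_erase]
        tauto
      rw [hsd]
      refine h1.trans ?_
      rw [neg_im_matchPolyOn_div_eq G hz hu, norm_div, div_pow, ← mul_assoc,
        mul_div_cancel₀ _ (pow_ne_zero 2 (norm_ne_zero_iff.2 h0))]
      refine mul_le_mul_of_nonneg_left ?_ (by positivity)
      refine (Finset.single_le_sum (f := fun v => -(aeval z
        (G.matchPolyOn ((S.erase u).erase v)) / aeval z (G.matchPolyOn (S.erase u))).im)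
        (fun w hw => ?_) hv).trans (le_add_of_nonneg_left hz.le)
      obtain ⟨hw, huw⟩ := Finset.mem_filter.1 hw
      exact hnonneg _ w (Finset.mem_erase.2 ⟨huw.ne', hw⟩)
  obtain ⟨u, L, rfl⟩ := List.exists_cons_of_ne_nil hne
  have hu : u ∈ S := hPS u (by simp)
  obtain ⟨h0, h1⟩ := G.im_le_im_matchPolyOn_div hz S
  have h2 := main L S u hP hnd hPS
  set w := aeval z (G.matchPolyOn S) / aeval z (G.matchPolyOn (S.erase u))
  have hw : z.im ≤ ‖w‖ := (h1 u hu).trans ((le_abs_self _).trans (Complex.abs_im_le_norm w))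
  have h3 : -(aeval z (G.matchPolyOn (S.erase u)) / aeval z (G.matchPolyOn S)).im ≤
      z.im⁻¹ := by
    rw [← inv_div]
    refine (neg_le_abs _).trans ((Complex.abs_im_le_norm _).trans ?_)
    rw [norm_inv]
    exact inv_anti₀ hz hw
  have h4 := h2.trans (mul_le_mul_of_nonneg_left h3 (by positivity))
  refine abs_le_of_sq_le_sq' ?_ (norm_nonneg _) |>.2
  rw [← div_eq_mul_inv, le_div_iff₀ hz] at h4
  linarith

end SimpleGraph

open Polynomial in
/-- A growth comparison on the vertical line through `c` bounds multiplicities at `c`. -/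
theorem Polynomial.rootMultiplicity_le_add_one_of_norm_le {f g : ℂ[X]} (hf : f ≠ 0) (hg : g ≠ 0)
    (c : ℂ) (h : ∀ t : ℝ, 0 < t →
      t * ‖g.eval (c + t * Complex.I)‖ ≤ ‖f.eval (c + t * Complex.I)‖) :
    f.rootMultiplicity c ≤ g.rootMultiplicity c + 1 := by
  by_contra! hlt
  obtain ⟨g₁, hg₁, hg₁c⟩ := exists_eq_pow_rootMultiplicity_mul_and_not_dvd g hg c
  obtain ⟨f₁, hf₁⟩ := (le_rootMultiplicity_iff hf).1 (Nat.succ_le_of_lt hlt)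
  set m := g.rootMultiplicity c
  have hne : g₁.eval c ≠ 0 := fun h0 => hg₁c (dvd_iff_isRoot.2 h0)
  have hle : ∀ t : ℝ, 0 < t →
      ‖g₁.eval (c + t * Complex.I)‖ ≤ t * ‖f₁.eval (c + t * Complex.I)‖ := by
    intro t ht
    have := h t ht
    rw [hg₁, hf₁] at this
    simp only [eval_mul, eval_pow, eval_sub, eval_X, eval_C, add_sub_cancel_left, norm_mul,
      norm_pow, Complex.norm_I, mul_one, Complex.norm_real, Real.norm_eq_abs, abs_of_pos ht] at this
    have hp : 0 < t ^ (m + 1) := by positivity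
    refine le_of_mul_le_mul_left ?_ hp
    calc _ = t * (t ^ m * ‖g₁.eval (c + t * Complex.I)‖) := by ring
      _ ≤ _ := this
      _ = _ := by rw [Nat.succ_eq_add_one]; ring
  have hcont : ∀ p : ℂ[X], Filter.Tendsto (fun t : ℝ => ‖p.eval (c + t * Complex.I)‖)
      (nhdsWithin 0 (Set.Ioi 0)) (nhds ‖p.eval c‖) := by
    intro p
    have : Continuous fun t : ℝ => ‖p.eval (c + t * Complex.I)‖ := by fun_prop
    simpa using (this.tendsto 0).mono_left nhdsWithin_le_nhds
  have hid : Filter.Tendsto (fun t : ℝ => t) (nhdsWithin 0 (Set.Ioi 0)) (nhds 0) :=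
    nhdsWithin_le_nhds
  have := le_of_tendsto_of_tendsto (hcont g₁) (hid.mul (hcont f₁))
    (Filter.eventually_of_mem self_mem_nhdsWithin hle)
  rw [zero_mul] at this
  exact hne (norm_le_zero_iff.1 this)

namespace SimpleGraph

open Polynomial
open scoped Classical

variable {V : Type*}

/-- If all zeros of the matching polynomial are real, the number of distinct zeros is at least the
number of vertices of any path, since deleting a path lowers each multiplicity by at most one. -/
theorem length_le_card_roots [Fintype V] (G : SimpleGraph V)
    (hreal : ∀ z : ℂ, aeval z (G.matchPolyOn Finset.univ) = 0 → z.im = 0)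
    {P : List V} (hP : P.IsChain G.Adj) (hnd : P.Nodup) :
    P.length ≤ ((G.matchPolyOn Finset.univ).map (algebraMap ℤ ℂ)).roots.toFinset.card := by
  rcases eq_or_ne P [] with rfl | hne
  · simp
  set f := (G.matchPolyOn Finset.univ).map (algebraMap ℤ ℂ)
  set g := (G.matchPolyOn (Finset.univ \ P.toFinset)).map (algebraMap ℤ ℂ)
  have hfm : f.Monic := (G.monic_matchPolyOn _).map _
  have hgm : g.Monic := (G.monic_matchPolyOn _).map _
  have hfd : f.natDegree = Fintype.card V := by
    rw [(G.monic_matchPolyOn _).natDegree_map, natDegree_matchPolyOn, Finset.card_univ]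
  have hgd : g.natDegree + P.length = Fintype.card V := by
    rw [(G.monic_matchPolyOn _).natDegree_map, natDegree_matchPolyOn,
      ← List.toFinset_card_of_nodup hnd, Finset.card_sdiff_add_card_eq_card (Finset.subset_univ _),
      Finset.card_univ]
  have hmul : ∀ c ∈ f.roots.toFinset, f.roots.count c ≤ g.roots.count c + 1 := by
    intro c hc
    have hc0 : aeval c (G.matchPolyOn Finset.univ) = 0 := by
      have := (mem_roots'.1 (Multiset.mem_toFinset.1 hc)).2
      rwa [IsRoot, eval_map_algebraMap] at this
    rw [count_roots, count_roots]
    refine rootMultiplicity_le_add_one_of_norm_le hfm.ne_zero hgm.ne_zero c fun t ht => ?_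
    rw [eval_map_algebraMap, eval_map_algebraMap]
    have him : (c + t * Complex.I).im = t := by simp [hreal c hc0]
    have := G.im_mul_norm_matchPolyOn_sdiff_le (z := c + t * Complex.I) (by rwa [him])
      (S := Finset.univ) hP hnd (by simp) hne
    rwa [him] at this
  have h1 : f.roots.card = f.natDegree := (IsAlgClosed.splits f).natDegree_eq_card_roots.symm
  have h2 : ∑ c ∈ f.roots.toFinset, g.roots.count c ≤ g.natDegree := by
    refine le_trans ?_ (card_roots' g)
    rw [← Multiset.toFinset_sum_count_eq g.roots,
      ← Finset.sum_filter_add_sum_filter_not f.roots.toFinset (· ∈ g.roots.toFinset),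
      Finset.sum_eq_zero (s := f.roots.toFinset.filter (· ∉ g.roots.toFinset)), add_zero]
    · exact Finset.sum_le_sum_of_subset fun c hc => (Finset.mem_filter.1 hc).2
    · intro c hc
      exact Multiset.count_eq_zero.2 fun h => (Finset.mem_filter.1 hc).2 (Multiset.mem_toFinset.2 h)
  have h3 := Finset.sum_le_sum hmul
  rw [Multiset.toFinset_sum_count_eq, Finset.sum_add_distrib, Finset.sum_const, smul_eq_mul,
    mul_one] at h3
  omega

end SimpleGraph

/-! ### Long paths in connected graphs -/

namespace SimpleGraph

open scoped Classical

variable {V : Type*}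

theorem exists_longest_path [Fintype V] (G : SimpleGraph V) :
    ∃ P : List V, P.IsChain G.Adj ∧ P.Nodup ∧
      ∀ Q : List V, Q.IsChain G.Adj → Q.Nodup → Q.length ≤ P.length := by
  let p : ℕ → Prop := fun n => ∃ P : List V, P.IsChain G.Adj ∧ P.Nodup ∧ P.length = n
  have hp : p 0 := ⟨[], by simp, by simp, rfl⟩
  obtain ⟨P, h1, h2, h3⟩ := Nat.findGreatest_spec (P := p) (Nat.zero_le (Fintype.card V)) hp
  exact ⟨P, h1, h2, fun Q hQ hnd => h3 ▸
    Nat.le_findGreatest hnd.length_le_card ⟨Q, hQ, hnd, rfl⟩⟩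

/-- The crossing edges of the Dirac–Pósa argument: in a path `P` with at most `2k` vertices whose
ends have at least `k` neighbours, all of them on `P`, some consecutive vertices `w`, `v` of `P` are
adjacent to the last and the first vertex respectively. -/
theorem exists_crossing_edges [Fintype V] (G : SimpleGraph V) {k : ℕ}
    (hdeg : ∀ u, k ≤ (Finset.univ.filter (G.Adj u)).card) {P : List V}
    {a b : V} (ha : P.head? = some a) (hb : P.getLast? = some b)
    (haP : ∀ v, G.Adj a v → v ∈ P) (hbP : ∀ v, G.Adj b v → v ∈ P) (hlen : P.length ≤ 2 * k) :
    ∃ L₁ L₂ w v, P = L₁ ++ L₂ ∧ L₁.getLast? = some w ∧ L₂.head? = some v ∧ G.Adj b w ∧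
      G.Adj a v := by
  have hpos : 0 < P.length := by
    rcases P with _ | _
    · simp at ha
    · simp
  have ha0 : P[0]? = some a := by rw [← ha, List.head?_eq_getElem?]
  have hb0 : P[P.length - 1]? = some b := by rw [← hb, List.getLast?_eq_getElem?]
  have hidx : ∀ {v}, v ∈ P → P[P.idxOf v]? = some v := fun {v} hv => by
    rw [List.getElem?_eq_getElem (List.idxOf_lt_length_iff.2 hv), List.getElem_idxOf]
  have hinj : ∀ {v w}, v ∈ P → w ∈ P → P.idxOf v = P.idxOf w → v = w := fun {v w} hv hw h => by
    have := hidx hv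
    rw [h, hidx hw] at this
    exact (Option.some.inj this).symm
  have hge : ∀ v, G.Adj a v → 1 ≤ P.idxOf v := fun v hv => by
    by_contra! h
    have h' := hidx (haP v hv)
    rw [Nat.lt_one_iff.1 h, ha0] at h'
    exact hv.ne (Option.some.inj h')
  have hlt : ∀ v, G.Adj b v → P.idxOf v < P.length - 1 := fun v hv => by
    have h1 := List.idxOf_lt_length_iff.2 (hbP v hv)
    rcases (by omega : P.idxOf v < P.length - 1 ∨ P.idxOf v = P.length - 1) with h | h
    · exact h
    · have h' := hidx (hbP v hv)
      rw [h, hb0] at h'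
      exact absurd (Option.some.inj h') hv.ne
  let A := (Finset.univ.filter (G.Adj a)).image fun v => P.idxOf v - 1
  let B := (Finset.univ.filter (G.Adj b)).image fun v => P.idxOf v
  have hA : k ≤ A.card := by
    rw [Finset.card_image_of_injOn]
    · exact hdeg a
    · intro v hv w hw h
      replace hv : G.Adj a v := by simpa using hv
      replace hw : G.Adj a w := by simpa using hw
      have := hge v hv
      have := hge w hw
      exact hinj (haP v hv) (haP w hw) (by simp only at h; omega)
  have hB : k ≤ B.card := by
    rw [Finset.card_image_of_injOn]
    · exact hdeg b
    · intro v hv w hw h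
      exact hinj (hbP v (by simpa using hv)) (hbP w (by simpa using hw)) h
  have hAB : A ∪ B ⊆ Finset.range (P.length - 1) := by
    intro i hi
    rw [Finset.mem_range]
    rcases Finset.mem_union.1 hi with hi | hi
    · obtain ⟨v, hv, rfl⟩ := Finset.mem_image.1 hi
      have hv : G.Adj a v := by simpa using hv
      have := hge v hv
      have := List.idxOf_lt_length_iff.2 (haP v hv)
      omega
    · obtain ⟨v, hv, rfl⟩ := Finset.mem_image.1 hi
      exact hlt v (by simpa using hv)
  have hne : (A ∩ B).Nonempty := by
    rw [← Finset.card_pos]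
    have h1 := Finset.card_union_add_card_inter A B
    have h2 := Finset.card_le_card hAB
    rw [Finset.card_range] at h2
    omega
  obtain ⟨i, hi⟩ := hne
  obtain ⟨v, hv, hvi⟩ := Finset.mem_image.1 (Finset.mem_inter.1 hi).1
  obtain ⟨w, hw, hwi⟩ := Finset.mem_image.1 (Finset.mem_inter.1 hi).2
  have hv : G.Adj a v := by simpa using hv
  have hw : G.Adj b w := by simpa using hw
  have hv1 := hge v hv
  have hvi' : P.idxOf v = i + 1 := by omega
  have hil : i < P.length - 1 := hwi ▸ hlt w hw
  refine ⟨P.take (i + 1), P.drop (i + 1), w, v, (List.take_append_drop _ _).symm, ?_, ?_, hw, hv⟩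
  · rw [List.getLast?_take, if_neg (by omega), Nat.add_sub_cancel, ← hwi, hidx (hbP w hw)]
    rfl
  · rw [List.head?_drop, ← hvi', hidx (haP v hv)]

/-- If the vertices of a path `C` close up to a cycle that misses some vertex, then cutting the
cycle open next to an edge leaving it gives a longer path. -/
theorem exists_longer_path_of_closed [Fintype V] {G : SimpleGraph V} (hG : G.Preconnected)
    {C : List V} (hC : C.IsChain G.Adj) (hnd : C.Nodup)
    (hclose : ∀ x ∈ C.getLast?, ∀ y ∈ C.head?, G.Adj x y) (hne : C ≠ [])
    (hlen : C.length < Fintype.card V) :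
    ∃ Q : List V, Q.IsChain G.Adj ∧ Q.Nodup ∧ Q.length = C.length + 1 := by
  obtain ⟨s, hs⟩ := List.exists_mem_of_ne_nil C hne
  obtain ⟨t, ht⟩ : ∃ t, t ∉ C := by
    by_contra! h
    have : Finset.univ ⊆ C.toFinset := fun x _ => List.mem_toFinset.2 (h x)
    have := Finset.card_le_card this
    rw [List.toFinset_card_of_nodup hnd, Finset.card_univ] at this
    omega
  obtain ⟨d, -, hd1, hd2⟩ := (hG s t).some.exists_boundary_dart {x | x ∈ C} hs ht
  obtain ⟨C₁, C₂, hCC⟩ := List.append_of_mem (show d.fst ∈ C from hd1)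
  rw [hCC, List.isChain_append] at hC
  refine ⟨d.snd :: ((d.fst :: C₂) ++ C₁), ?_, ?_, ?_⟩
  · rw [List.cons_append, List.isChain_cons_cons, ← List.cons_append, List.isChain_append]
    refine ⟨d.adj.symm, hC.2.1, hC.1, fun x hx y hy => hclose x ?_ y ?_⟩
    · rw [hCC, List.getLast?_append, Option.mem_def.1 hx]
      rfl
    · rw [hCC, List.head?_append, Option.mem_def.1 hy]
      rfl
  · have hperm : (d.fst :: C₂ ++ C₁).Perm C := by
      rw [hCC]
      exact List.perm_append_comm
    exact List.nodup_cons.2 ⟨fun h => hd2 (hperm.mem_iff.1 h), hperm.nodup_iff.2 hnd⟩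
  · rw [hCC]
    simp
    omega

/-- Dirac's theorem on long paths: a connected graph on `n` vertices with minimum degree at least
`k` has a path with at least `min n (2k + 1)` vertices. -/
theorem exists_path_min_card_le_length [Fintype V] {G : SimpleGraph V} (hG : G.Preconnected) {k : ℕ}
    (hdeg : ∀ u, k ≤ (Finset.univ.filter (G.Adj u)).card) :
    ∃ P : List V, P.IsChain G.Adj ∧ P.Nodup ∧ min (Fintype.card V) (2 * k + 1) ≤ P.length := by
  obtain ⟨P, hP, hnd, hmax⟩ := G.exists_longest_path
  refine ⟨P, hP, hnd, ?_⟩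
  by_contra! hlt
  obtain ⟨hlt1, hlt2⟩ := lt_min_iff.1 hlt
  have hsymm : ∀ L : List V, L.IsChain G.Adj → L.reverse.IsChain G.Adj := fun L hL =>
    List.isChain_reverse.2 (hL.imp fun _ _ h => h.symm)
  have hPne : P ≠ [] := by
    rintro rfl
    obtain ⟨x⟩ := Fintype.card_pos_iff.1 ((Nat.zero_le _).trans_lt hlt1)
    simpa using hmax [x] (by simp) (by simp)
  obtain ⟨a, ha⟩ : ∃ a, P.head? = some a := ⟨_, List.head?_eq_some_head hPne⟩
  obtain ⟨b, hb⟩ : ∃ b, P.getLast? = some b := ⟨_, List.getLast?_eq_some_getLast hPne⟩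
  have hend : ∀ (Q : List V) (c : V), Q.IsChain G.Adj → Q.Nodup → Q.length = P.length →
      Q.head? = some c → ∀ v, G.Adj c v → v ∈ Q := by
    intro Q c hQ hQnd hQl hc v hv
    by_contra hvQ
    have := hmax (v :: Q) (List.isChain_cons.2 ⟨fun y hy => by
      rw [hc, Option.mem_some_iff] at hy
      exact hy ▸ hv.symm, hQ⟩) (List.nodup_cons.2 ⟨hvQ, hQnd⟩)
    simp at this
    omega
  have hbP : ∀ v, G.Adj b v → v ∈ P := fun v hv => List.mem_reverse.1 <|
    hend P.reverse b (hsymm P hP) (List.nodup_reverse.2 hnd) (by simp) (by simpa using hb) v hv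
  obtain ⟨L₁, L₂, w, v, hL, hw, hv, hbw, hav⟩ := G.exists_crossing_edges hdeg ha hb
    (hend P a hP hnd rfl ha) hbP (by omega)
  -- The crossing edges close `P` up to the cycle `L₁ ++ L₂.reverse`.
  have hperm : (L₁ ++ L₂.reverse).Perm P := by
    rw [hL]
    exact (List.reverse_perm L₂).append_left L₁
  have hL1 : L₁ ≠ [] := by
    rintro rfl
    simp at hw
  have hL2 : L₂ ≠ [] := by
    rintro rfl
    simp at hv
  rw [hL, List.head?_append_of_ne_nil _ hL1] at ha
  rw [hL, List.getLast?_append_of_ne_nil _ hL2] at hb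
  rw [hL, List.isChain_append] at hP
  obtain ⟨Q, hQ, hQnd, hQl⟩ := exists_longer_path_of_closed hG (C := L₁ ++ L₂.reverse)
    (List.isChain_append.2 ⟨hP.1, hsymm _ hP.2.1, fun x hx y hy => by
      rw [hw, Option.mem_some_iff] at hx
      rw [List.head?_reverse, hb, Option.mem_some_iff] at hy
      exact hx ▸ hy ▸ hbw.symm⟩) (hperm.nodup_iff.2 hnd)
    (fun x hx y hy => by
      rw [List.getLast?_append_of_ne_nil _ (by simpa using hL2), List.getLast?_reverse, hv,
        Option.mem_some_iff] at hx
      rw [List.head?_append_of_ne_nil _ hL1, ha, Option.mem_some_iff] at hy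
      exact hx ▸ hy ▸ hav.symm) (by simp [hL1]) (by rw [hperm.length_eq]; exact hlt1)
  have := hmax Q hQ hQnd
  rw [hQl, hperm.length_eq] at this
  omega

end SimpleGraph

/-! ### The zeros of a connected regular matching integral graph -/

open Polynomial in
theorem Polynomial.coeff_prod_X_sub_C_sub_one (s : Finset ℤ) (m : ℕ) (hm : s.card = m + 1) :
    (∏ r ∈ s, (X - C r)).coeff m = -∑ r ∈ s, r := by
  have := prod_X_sub_C_coeff_card_pred s (fun r : ℤ => r) (by omega)
  rwa [hm, Nat.add_sub_cancel] at this

open Polynomial in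
theorem Polynomial.two_mul_coeff_prod_X_sub_C_sub_two (s : Finset ℤ) (m : ℕ)
    (hm : s.card = m + 2) :
    2 * (∏ r ∈ s, (X - C r)).coeff m = (∑ r ∈ s, r) ^ 2 - ∑ r ∈ s, r ^ 2 := by
  induction s using Finset.induction_on generalizing m with
  | empty => simp at hm
  | insert a s ha ih =>
    rw [Finset.card_insert_of_notMem ha] at hm
    rw [Finset.prod_insert ha, Finset.sum_insert ha, Finset.sum_insert ha]
    have h1 := coeff_prod_X_sub_C_sub_one s m (by omega)
    rcases m with _ | m
    · obtain ⟨b, rfl⟩ := Finset.card_eq_one.1 (by omega : s.card = 1)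
      simp
      ring
    · rw [coeff_X_sub_C_mul, h1, mul_sub, ih m (by omega)]
      ring

/-- The arithmetic of the problem: `eᵢ` records whether `±i` is a zero, and the hypotheses express
the Heilmann–Lieb bound, the sum of the squares of the zeros and the number of zeros. -/
theorem zeros_enumeration : ∀ k : Fin 15, 2 ≤ k.val → ∀ e₀ e₁ e₂ e₃ e₄ e₅ e₆ e₇ : Bool,
    (e₂ = true → 4 < 4 * (k.val - 1)) → (e₃ = true → 9 < 4 * (k.val - 1)) →
    (e₄ = true → 16 < 4 * (k.val - 1)) → (e₅ = true → 25 < 4 * (k.val - 1)) →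
    (e₆ = true → 36 < 4 * (k.val - 1)) → (e₇ = true → 49 < 4 * (k.val - 1)) →
    k.val + 1 ≤ e₀.toNat + 2 * (e₁.toNat + e₂.toNat + e₃.toNat + e₄.toNat + e₅.toNat + e₆.toNat +
      e₇.toNat) →
    2 * (e₁.toNat + 4 * e₂.toNat + 9 * e₃.toNat + 16 * e₄.toNat + 25 * e₅.toNat + 36 * e₆.toNat +
      49 * e₇.toNat) = (e₀.toNat + 2 * (e₁.toNat + e₂.toNat + e₃.toNat + e₄.toNat + e₅.toNat +
      e₆.toNat + e₇.toNat)) * k.val →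
    e₁ = true ∧ ((k.val = 4 ∧ e₀.toNat + 2 * (e₁.toNat + e₂.toNat + e₃.toNat + e₄.toNat + e₅.toNat +
      e₆.toNat + e₇.toNat) = 7) ∨ (k.val + 1 = e₀.toNat + 2 * (e₁.toNat + e₂.toNat + e₃.toNat +
      e₄.toNat + e₅.toNat + e₆.toNat + e₇.toNat) ∧ (k.val = 4 ∨ k.val = 6 ∨ k.val = 10))) := by
  decide

open scoped Classical in
theorem sum_eq_of_symmetric {R : Finset ℤ} (hR : R ⊆ Finset.Icc (-7) 7) (hneg : ∀ r ∈ R, -r ∈ R)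
    (f : ℤ → ℕ) (hf : ∀ r, f (-r) = f r) :
    ∑ r ∈ R, f r = (decide (0 ∈ R)).toNat * f 0 + 2 * ((decide (1 ∈ R)).toNat * f 1 +
      (decide (2 ∈ R)).toNat * f 2 + (decide (3 ∈ R)).toNat * f 3 + (decide (4 ∈ R)).toNat * f 4 +
      (decide (5 ∈ R)).toNat * f 5 + (decide (6 ∈ R)).toNat * f 6 +
      (decide (7 ∈ R)).toNat * f 7) := by
  have hmem : ∀ r, -r ∈ R ↔ r ∈ R := fun r => ⟨fun h => by simpa using hneg _ h, hneg r⟩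
  have hI : Finset.Icc (-7 : ℤ) 7 =
      {-7, -6, -5, -4, -3, -2, -1, 0, 1, 2, 3, 4, 5, 6, 7} := by decide
  have h1 : ∑ r ∈ R, f r = ∑ r ∈ Finset.Icc (-7 : ℤ) 7, if r ∈ R then f r else 0 := by
    rw [← Finset.sum_filter]
    refine Finset.sum_congr ?_ fun _ _ => rfl
    ext r
    simp only [Finset.mem_filter]
    exact ⟨fun h => ⟨hR h, h⟩, fun h => h.2⟩
  have h2 : ∀ r, (if r ∈ R then f r else 0) = (decide (r ∈ R)).toNat * f r := fun r => by
    by_cases h : r ∈ R <;> simp [h]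
  rw [h1, hI]
  repeat rw [Finset.sum_insert (by decide)]
  simp only [Finset.sum_singleton, hmem, hf, h2]
  ring

namespace SimpleGraph

open Polynomial
open scoped Classical

variable {V : Type*}

theorem numMatchings_one [Fintype V] (G : SimpleGraph V) :
    G.numMatchings 1 = G.edgeFinset.card := by
  rw [numMatchings, ← Set.ncard_coe_finset, coe_edgeFinset,
    ← Set.ncard_image_of_injective _ (Finset.singleton_injective (α := Sym2 V))]
  congr 1
  ext M
  simp only [Set.mem_ofPred_eq, Set.mem_image, Finset.card_eq_one]
  constructor
  · rintro ⟨h, e, rfl⟩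
    exact ⟨e, h.1 e (by simp), rfl⟩
  · rintro ⟨e, he, rfl⟩
    refine ⟨⟨by simpa using he, fun e' he' f hf hne => ?_⟩, e, rfl⟩
    rw [Finset.mem_singleton.1 he', Finset.mem_singleton.1 hf] at hne
    exact absurd rfl hne

theorem coeff_matchingPolynomial_sub_two [Fintype V] (G : SimpleGraph V)
    (hV : 2 ≤ Fintype.card V) :
    G.matchingPolynomial.coeff (Fintype.card V - 2) = -(G.edgeFinset.card : ℤ) := by
  rw [matchingPolynomial, finsetSum_coeff, Finset.sum_eq_single 1]
  · simp [numMatchings_one, coeff_X_pow]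
  · intro r hr hr1
    rw [Finset.mem_range] at hr
    rw [coeff_C_mul, coeff_X_pow, if_neg (by omega), mul_zero]
  · intro h
    rw [Finset.mem_range] at h
    omega

/-- The zeros of a connected `k`-regular matching integral graph with `k ≥ 2`: the number `1` is a
zero, and the graph has degree `4` and order `7`, or is complete of order `5`, `7` or `11`. -/
theorem isRoot_one_and_card_of_connected [Fintype V] {G : SimpleGraph V} (hconn : G.Connected)
    {k : ℕ} (hk : 2 ≤ k) (hreg : ∀ u, (Finset.univ.filter (G.Adj u)).card = k)
    (hG : G.IsMatchingIntegral) :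
    aeval (1 : ℤ) (G.matchPolyOn Finset.univ) = 0 ∧ ((k = 4 ∧ Fintype.card V = 7) ∨
      (k + 1 = Fintype.card V ∧ (k = 4 ∨ k = 6 ∨ k = 10))) := by
  have hint : ∀ z : ℂ, aeval z (G.matchPolyOn Finset.univ) = 0 → ∃ m : ℤ, z = m := by
    simpa only [IsMatchingIntegral, matchingPolynomial_eq_matchPolyOn_univ] using hG
  set p := G.matchPolyOn Finset.univ with hp
  have hpm : p.Monic := G.monic_matchPolyOn _
  have hpd : p.natDegree = Fintype.card V := by
    rw [hp, natDegree_matchPolyOn, Finset.card_univ]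
  set R := p.roots.toFinset with hRdef
  have hmemR : ∀ r, r ∈ R ↔ aeval r p = 0 := by
    intro r
    rw [hRdef, Multiset.mem_toFinset, mem_roots hpm.ne_zero, IsRoot, coe_aeval_eq_eval]
  -- The complex zeros are the integer zeros, so a long path forces many integer zeros.
  obtain ⟨P, hP, hnd, hPl⟩ := exists_path_min_card_le_length hconn.preconnected
    (fun u => (hreg u).ge)
  have hcardR : min (Fintype.card V) (2 * k + 1) ≤ R.card := by
    refine hPl.trans ((G.length_le_card_roots (fun z hz => ?_) hP hnd).trans ?_)
    · obtain ⟨m, rfl⟩ := hint z hz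
      simp
    · refine (Finset.card_le_card (t := R.image (Int.cast : ℤ → ℂ)) fun z hz => ?_).trans
        Finset.card_image_le
      have hz0 : aeval z p = 0 := by
        have := (mem_roots'.1 (Multiset.mem_toFinset.1 hz)).2
        rwa [IsRoot, eval_map_algebraMap] at this
      obtain ⟨m, rfl⟩ := hint z hz0
      refine Finset.mem_image.2 ⟨m, (hmemR m).2 ?_, rfl⟩
      have := aeval_algebraMap_apply ℂ m p
      rw [eq_intCast, hz0, eq_intCast] at this
      exact_mod_cast this.symm
  have hRle : R.card ≤ Fintype.card V :=
    (Multiset.toFinset_card_le _).trans ((card_roots' p).trans hpd.le)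
  have hsq : ∀ r ∈ R, r ^ 2 < 4 * ((k : ℤ) - 1) := fun r hr =>
    G.sq_lt_of_aeval_matchPolyOn_eq_zero hk (fun u => (hreg u).le) ((hmemR r).1 hr)
  have hneg : ∀ r ∈ R, -r ∈ R := fun r hr => by
    rw [hmemR, hp, aeval_neg_matchPolyOn, ← hp, (hmemR r).1 hr, mul_zero]
  have hkn : k + 1 ≤ Fintype.card V := by
    obtain ⟨u⟩ := hconn.nonempty
    rw [← hreg u, Nat.add_one_le_iff]
    exact Finset.card_lt_univ_of_notMem (x := u) (by simp)
  -- `B` is the largest integer allowed as a zero by the Heilmann–Lieb bound.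
  set B := Nat.sqrt (4 * k - 5) with hB
  have hB2 : B * B ≤ 4 * k - 5 := Nat.sqrt_le _
  have hRB : R ⊆ Finset.Icc (-(B : ℤ)) B := by
    intro r hr
    have h1 := hsq r hr
    have h2 : r.natAbs ≤ B := by
      rw [hB, Nat.le_sqrt]
      have : ((r.natAbs * r.natAbs : ℕ) : ℤ) = r ^ 2 := by rw [Int.natAbs_mul_self, sq]
      omega
    rw [Finset.mem_Icc]
    omega
  have hRB' : R.card ≤ 2 * B + 1 := by
    have := Finset.card_le_card hRB
    rw [Int.card_Icc] at this
    omega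
  have hn : Fintype.card V ≤ 2 * k := by
    by_contra! h
    have h1 : k ≤ B := by omega
    have h2 : (k : ℤ) * k ≤ B * B := by exact_mod_cast Nat.mul_le_mul h1 h1
    have h3 : (B : ℤ) * B ≤ 4 * k - 5 := by
      have : ((B * B : ℕ) : ℤ) = (B : ℤ) * B := by push_cast; ring
      omega
    nlinarith [sq_nonneg ((k : ℤ) - 2)]
  have hRn : R.card = Fintype.card V := by omega
  have hB7 : B ≤ 7 := by
    by_contra! h
    have h1 : k ≤ 2 * B := by omega
    have h2 : 8 * B ≤ B * B := Nat.mul_le_mul_right B h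
    omega
  have hk15 : k < 15 := by omega
  have hR7 : R ⊆ Finset.Icc (-7) 7 := hRB.trans (Finset.Icc_subset_Icc (by omega) (by omega))
  -- All zeros are simple, so the second coefficient of `p` is read off from the zeros.
  have hrc : p.roots.card = p.natDegree := by
    refine le_antisymm (card_roots' p) ?_
    rw [hpd, ← hRn]
    exact Multiset.toFinset_card_le _
  have hnodup : p.roots.Nodup := by
    rw [← Multiset.toFinset_card_eq_card_iff_nodup, hrc, hpd, ← hRn]
  have hprod : ∏ r ∈ R, (X - C r) = p := by
    rw [← prod_multiset_X_sub_C_of_monic_of_roots_card_eq hpm hrc, Finset.prod, hRdef,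
      Multiset.toFinset_val, hnodup.dedup]
  have hsum0 : ∑ r ∈ R, r = 0 := by
    have : ∑ r ∈ R, r = ∑ r ∈ R, -r :=
      Finset.sum_bij' (fun r _ => -r) (fun r _ => -r) hneg hneg (by simp) (by simp) (by simp)
    rw [Finset.sum_neg_distrib] at this
    omega
  have hcoeff := two_mul_coeff_prod_X_sub_C_sub_two R (Fintype.card V - 2) (by omega)
  rw [hprod, hp, ← matchingPolynomial_eq_matchPolyOn_univ,
    coeff_matchingPolynomial_sub_two G (by omega), hsum0] at hcoeff
  have hedge : 2 * G.edgeFinset.card = Fintype.card V * k := by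
    rw [← G.sum_degrees_eq_twice_card_edges, Finset.sum_congr rfl (g := fun _ => k),
      Finset.sum_const, Finset.card_univ, smul_eq_mul]
    intro u _
    rw [← hreg u, ← card_neighborFinset_eq_degree, neighborFinset_eq_filter]
  have hsumsq : ∑ r ∈ R, r.natAbs ^ 2 = Fintype.card V * k := by
    have h1 : ((∑ r ∈ R, r.natAbs ^ 2 : ℕ) : ℤ) = ∑ r ∈ R, r ^ 2 := by
      push_cast
      exact Finset.sum_congr rfl fun r _ => sq_abs r
    zify at hedge ⊢
    push_cast at h1
    linarith
  have hS2 := sum_eq_of_symmetric hR7 hneg (fun r => r.natAbs ^ 2) (by simp)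
  have hS0 := sum_eq_of_symmetric hR7 hneg (fun _ => 1) (by simp)
  rw [hsumsq] at hS2
  rw [Finset.sum_const, smul_eq_mul, mul_one, hRn] at hS0
  have hbd : ∀ i : ℕ, decide ((i : ℤ) ∈ R) = true → i ^ 2 < 4 * (k - 1) := by
    intro i hi
    have := hsq _ (of_decide_eq_true hi)
    zify
    omega
  have hfin := zeros_enumeration ⟨k, hk15⟩ hk (decide (0 ∈ R)) (decide (1 ∈ R)) (decide (2 ∈ R))
    (decide (3 ∈ R)) (decide (4 ∈ R)) (decide (5 ∈ R)) (decide (6 ∈ R)) (decide (7 ∈ R))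
    (hbd 2) (hbd 3) (hbd 4) (hbd 5) (hbd 6) (hbd 7)
  simp only [mul_one] at hS0
  rw [← hS0] at hfin
  obtain ⟨h1, h2⟩ := hfin hkn (by
    rw [hS2]
    simp only [show Int.natAbs 0 = 0 from rfl, show Int.natAbs 1 = 1 from rfl,
      show Int.natAbs 2 = 2 from rfl, show Int.natAbs 3 = 3 from rfl,
      show Int.natAbs 4 = 4 from rfl, show Int.natAbs 5 = 5 from rfl,
      show Int.natAbs 6 = 6 from rfl, show Int.natAbs 7 = 7 from rfl]
    ring)
  exact ⟨(hmemR 1).1 (of_decide_eq_true h1), h2.imp id fun h => ⟨h.1, h.2⟩⟩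

end SimpleGraph

/-! ### Regular graphs of degree four on seven vertices -/

namespace SimpleGraph

/-- The values at `1` of matching polynomials, computed on a list of vertices by expansion along its
head; the first argument bounds the recursion. -/
def matchEvalOne {α : Type*} [DecidableEq α] (adj : α → α → Bool) : ℕ → List α → ℤ
  | 0, _ => 1
  | _ + 1, [] => 1
  | n + 1, u :: L =>
    matchEvalOne adj n L - ((L.filter (adj u)).map fun v => matchEvalOne adj n (L.erase v)).sum

/-- The successor of a vertex along the two cycles of `C₃ ∪ C₄`. -/
def nextC3C4 : Fin 3 ⊕ Fin 4 → Fin 3 ⊕ Fin 4 := Sum.map (· + 1) (· + 1)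

/-- The predecessor of a vertex along the two cycles of `C₃ ∪ C₄`. -/
def prevC3C4 : Fin 3 ⊕ Fin 4 → Fin 3 ⊕ Fin 4 := Sum.map (· - 1) (· - 1)

theorem K7MinusC3C4_compl_adj : ∀ i j : Fin 3 ⊕ Fin 4,
    K7MinusC3C4ᶜ.Adj i j ↔ j = nextC3C4 i ∨ j = prevC3C4 i := by
  rintro (i | i) (j | j) <;> fin_cases i <;> fin_cases j <;>
    simp [K7MinusC3C4, nextC3C4, prevC3C4, cycleGraph_adj] <;> decide

theorem matchEvalOne_compl_cycleGraph_seven :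
    matchEvalOne (fun i j => decide ((cycleGraph 7)ᶜ.Adj i j)) 7 (List.finRange 7) ≠ 0 := by
  decide

open Polynomial
open scoped Classical

variable {V : Type*}

theorem aeval_one_matchPolyOn_eq_matchEvalOne [Fintype V] [inst : DecidableEq V]
    (G : SimpleGraph V) (adj : V → V → Bool) (hadj : ∀ u v, adj u v = true ↔ G.Adj u v) (n : ℕ) :
    ∀ (L : List V) (S : Finset V), L.Nodup → L.length ≤ n → (∀ x, x ∈ S ↔ x ∈ L) →
      aeval (1 : ℤ) (G.matchPolyOn S) = matchEvalOne adj n L := by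
  obtain rfl : inst = fun a b => Classical.propDecidable (a = b) := Subsingleton.elim _ _
  induction n with
  | zero =>
    intro L S _ hL hS
    have hL' : L = [] := List.length_eq_zero_iff.1 (by omega)
    have : S = ∅ := Finset.eq_empty_of_forall_notMem fun x => by simp [hS, hL']
    simp [this, matchPolyOn_empty, matchEvalOne]
  | succ n ih =>
    intro L S hnd hL hS
    rcases L with _ | ⟨u, L⟩
    · have : S = ∅ := Finset.eq_empty_of_forall_notMem fun x => by simp [hS]
      simp [this, matchPolyOn_empty, matchEvalOne]
    · obtain ⟨hu, hnd⟩ := List.nodup_cons.1 hnd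
      rw [List.length_cons] at hL
      have hS' : ∀ x, x ∈ S.erase u ↔ x ∈ L := fun x => by
        rw [Finset.mem_erase, hS, List.mem_cons]
        exact ⟨fun h => h.2.resolve_left h.1, fun h => ⟨fun hx => hu (hx ▸ h), Or.inr h⟩⟩
      have hfil : S.filter (G.Adj u) = (L.filter (adj u)).toFinset := by
        ext x
        rw [Finset.mem_filter, List.mem_toFinset, List.mem_filter, hadj, hS, List.mem_cons]
        exact ⟨fun h => ⟨h.1.resolve_left h.2.ne', h.2⟩, fun h => ⟨Or.inr h.1, h.2⟩⟩
      have h1 := ih L _ hnd (by omega) hS'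
      rw [aeval_matchPolyOn_expand G _ ((hS u).2 (by simp)), matchEvalOne]
      rw [h1, one_mul, hfil, List.sum_toFinset _ (hnd.filter _)]
      congr 2
      refine List.map_congr_left fun v hv => ?_
      refine ih _ _ (hnd.erase v) ((List.length_erase_le).trans (by omega)) fun x => ?_
      rw [Finset.mem_erase, hS', hnd.mem_erase_iff]

theorem aeval_one_compl_cycleGraph_seven :
    aeval (1 : ℤ) ((cycleGraph 7)ᶜ.matchPolyOn Finset.univ) ≠ 0 := by
  rw [aeval_one_matchPolyOn_eq_matchEvalOne _ (fun i j => decide ((cycleGraph 7)ᶜ.Adj i j))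
    (by simp) 7 (List.finRange 7) _ (List.nodup_finRange 7) (by simp) (by simp)]
  exact matchEvalOne_compl_cycleGraph_seven

/-- Two graphs are isomorphic if their complements are given by neighbour functions `s` and
`t` that correspond under a bijection. -/
theorem nonempty_iso_of_compl_adj {W : Type*} {G : SimpleGraph V} {H : SimpleGraph W} {f : W → V}
    (hf : Function.Bijective f) {s t : W → W}
    (hG : ∀ i w, Gᶜ.Adj (f i) w ↔ w = f (s i) ∨ w = f (t i))
    (hH : ∀ i j, Hᶜ.Adj i j ↔ j = s i ∨ j = t i) : Nonempty (G ≃g H) := by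
  refine ⟨RelIso.symm ⟨Equiv.ofBijective f hf, fun {i j} => ?_⟩⟩
  have h : Gᶜ.Adj (f i) (f j) ↔ Hᶜ.Adj i j := by
    rw [hG, hH, hf.injective.eq_iff, hf.injective.eq_iff]
  by_cases hij : i = j
  · simp [hij]
  · simpa [compl_adj, hij, hf.injective.eq_iff, not_iff_not] using h

theorem exists_other_neighbor [Fintype V] {H : SimpleGraph V}
    (hH : ∀ u, (Finset.univ.filter (H.Adj u)).card = 2) {u a : V} (hua : H.Adj u a) :
    ∃ b, b ≠ a ∧ H.Adj u b ∧ ∀ w, H.Adj u w ↔ w = a ∨ w = b := by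
  obtain ⟨x, y, hxy, he⟩ := Finset.card_eq_two.1 (hH u)
  have hw : ∀ w, H.Adj u w ↔ w = x ∨ w = y := fun w => by
    have := Finset.ext_iff.1 he w
    simpa using this
  rcases (hw a).1 hua with rfl | rfl
  · exact ⟨y, hxy.symm, (hw y).2 (Or.inr rfl), hw⟩
  · exact ⟨x, hxy, (hw x).2 (Or.inl rfl), fun w => (hw w).trans or_comm⟩

theorem not_nodup_of_eight_le [Fintype V] (hV : Fintype.card V = 7) {l : List V}
    (hl : 8 ≤ l.length) : ¬ l.Nodup := fun h => by
  have := h.length_le_card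
  omega

theorem exists_not_mem_of_length_lt [Fintype V] (l : List V) (hl : l.length < Fintype.card V) :
    ∃ x, x ∉ l := by
  by_contra! h
  have := Finset.card_le_card (fun x _ => List.mem_toFinset.2 (h x) :
    (Finset.univ : Finset V) ⊆ l.toFinset)
  rw [Finset.card_univ] at this
  have := l.toFinset_card_le
  omega

theorem exists_two_neighbors [Fintype V] {H : SimpleGraph V}
    (hH : ∀ u, (Finset.univ.filter (H.Adj u)).card = 2) (u : V) :
    ∃ a b, b ≠ a ∧ H.Adj u a ∧ H.Adj u b ∧ ∀ w, H.Adj u w ↔ w = a ∨ w = b := by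
  obtain ⟨a, ha⟩ : (Finset.univ.filter (H.Adj u)).Nonempty := by
    rw [← Finset.card_pos, hH]
    norm_num
  have ha : H.Adj u a := by simpa using ha
  obtain ⟨b, h⟩ := exists_other_neighbor hH ha
  exact ⟨a, b, h.1, ha, h.2⟩

/-- Disjoint cycles `u a b` and `x y w z` in which no vertex has further neighbours give an
embedding of `C₃ ∪ C₄`. -/
theorem exists_embedding_C3C4 {H : SimpleGraph V} {u a b x y w z : V}
    (hnd : [u, a, b, x, y, w, z].Nodup)
    (hu : ∀ v, H.Adj u v ↔ v = a ∨ v = b) (ha : ∀ v, H.Adj a v ↔ v = u ∨ v = b)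
    (hb : ∀ v, H.Adj b v ↔ v = u ∨ v = a) (hx : ∀ v, H.Adj x v ↔ v = y ∨ v = z)
    (hy : ∀ v, H.Adj y v ↔ v = x ∨ v = w) (hw : ∀ v, H.Adj w v ↔ v = y ∨ v = z)
    (hz : ∀ v, H.Adj z v ↔ v = x ∨ v = w) :
    ∃ f : Fin 3 ⊕ Fin 4 → V, Function.Injective f ∧
      ∀ i w, H.Adj (f i) w ↔ w = f (nextC3C4 i) ∨ w = f (prevC3C4 i) := by
  refine ⟨fun i => [u, a, b, x, y, w, z].get (finSumFinEquiv (m := 3) (n := 4) i),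
    (List.nodup_iff_injective_get.1 hnd).comp finSumFinEquiv.injective, ?_⟩
  rintro (i | i) v <;> fin_cases i
  · exact hu v
  · exact (ha v).trans or_comm
  · exact hb v
  · exact hx v
  · exact (hy v).trans or_comm
  · exact (hw v).trans or_comm
  · exact hz v

/-- A cycle `u a c e h d b` in which no vertex has further neighbours gives an embedding of
`C₇`. -/
theorem exists_embedding_C7 {H : SimpleGraph V} {u a c e h d b : V}
    (hnd : [u, a, c, e, h, d, b].Nodup)
    (hu : ∀ v, H.Adj u v ↔ v = a ∨ v = b) (ha : ∀ v, H.Adj a v ↔ v = u ∨ v = c)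
    (hc : ∀ v, H.Adj c v ↔ v = a ∨ v = e) (he : ∀ v, H.Adj e v ↔ v = c ∨ v = h)
    (hh : ∀ v, H.Adj h v ↔ v = d ∨ v = e) (hd : ∀ v, H.Adj d v ↔ v = b ∨ v = h)
    (hb : ∀ v, H.Adj b v ↔ v = u ∨ v = d) :
    ∃ f : Fin 7 → V, Function.Injective f ∧
      ∀ i w, H.Adj (f i) w ↔ w = f (i + 1) ∨ w = f (i - 1) := by
  refine ⟨[u, a, c, e, h, d, b].get, List.nodup_iff_injective_get.1 hnd, ?_⟩
  intro i v
  fin_cases i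
  · exact hu v
  · exact (ha v).trans or_comm
  · exact (hc v).trans or_comm
  · exact (he v).trans or_comm
  · exact hh v
  · exact hd v
  · exact hb v

/-- A `2`-regular graph on seven vertices is `C₃ ∪ C₄` or `C₇`. -/
theorem two_regular_seven [Fintype V] {H : SimpleGraph V} (hV : Fintype.card V = 7)
    (hH : ∀ u, (Finset.univ.filter (H.Adj u)).card = 2) :
    (∃ f : Fin 3 ⊕ Fin 4 → V, Function.Injective f ∧
      ∀ i w, H.Adj (f i) w ↔ w = f (nextC3C4 i) ∨ w = f (prevC3C4 i)) ∨
    (∃ f : Fin 7 → V, Function.Injective f ∧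
      ∀ i w, H.Adj (f i) w ↔ w = f (i + 1) ∨ w = f (i - 1)) := by
  have hsymm : ∀ v w, H.Adj v w → H.Adj w v := fun v w h => h.symm
  have hirr : ∀ v, ¬ H.Adj v v := fun v => H.irrefl
  obtain ⟨u⟩ := Fintype.card_pos_iff.1 (hV ▸ (by norm_num) : 0 < Fintype.card V)
  obtain ⟨a, b, hab, hua, hub, hu⟩ := exists_two_neighbors hH u
  obtain ⟨c, hcu, hac, ha⟩ := exists_other_neighbor hH hua.symm
  obtain ⟨d, hdu, hbd, hb⟩ := exists_other_neighbor hH hub.symm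
  -- The path `c a u b d` around `u` closes up to a cycle of length `3` if `c = b`, of length `4` if
  -- `c = d`, and otherwise of length `7`, counting vertices each time.
  by_cases hcb : c = b
  · subst hcb
    have hda : d = a := by grind
    subst hda
    obtain ⟨x, hx⟩ := exists_not_mem_of_length_lt [u, d, c] (by simp [hV])
    simp only [List.mem_cons, List.not_mem_nil, not_or] at hx
    obtain ⟨y, z, hzy, hxy, hxz, hxn⟩ := exists_two_neighbors hH x
    obtain ⟨w, hwx, hyw, hy⟩ := exists_other_neighbor hH hxy.symm
    obtain ⟨w', hwx', hzw, hz⟩ := exists_other_neighbor hH hxz.symm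
    have hy3 : y ≠ u ∧ y ≠ d ∧ y ≠ c ∧ y ≠ x := by grind
    have hz3 : z ≠ u ∧ z ≠ d ∧ z ≠ c ∧ z ≠ x := by grind
    have hw3 : w ≠ u ∧ w ≠ d ∧ w ≠ c ∧ w ≠ y := by grind
    have hw3' : w' ≠ u ∧ w' ≠ d ∧ w' ≠ c ∧ w' ≠ z := by grind
    have hwz : w ≠ z := by
      rintro rfl
      obtain ⟨p, hp⟩ := exists_not_mem_of_length_lt [u, d, c, x, y, w] (by simp [hV])
      simp only [List.mem_cons, List.not_mem_nil, not_or] at hp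
      obtain ⟨q, r, hqr, hpq, hpr, hpn⟩ := exists_two_neighbors hH p
      refine not_nodup_of_eight_le hV (l := [u, d, c, x, y, w, p, q]) (by simp) ?_
      simp only [List.nodup_cons, List.mem_cons, List.not_mem_nil, or_false, not_or,
        not_false_eq_true, List.nodup_nil, and_true]
      split_ands <;> grind
    have hwy' : w' ≠ y := by grind
    have hww : w' = w := by
      by_contra hne
      refine not_nodup_of_eight_le hV (l := [u, d, c, x, y, z, w, w']) (by simp) ?_
      simp only [List.nodup_cons, List.mem_cons, List.not_mem_nil, or_false, not_or,
        not_false_eq_true, List.nodup_nil, and_true]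
      split_ands <;> grind
    subst hww
    obtain ⟨v, hvy, hwv, hw⟩ := exists_other_neighbor hH hyw.symm
    have hvz : v = z := by grind
    subst hvz
    refine Or.inl (exists_embedding_C3C4 ?_ hu ha hb hxn hy hw hz)
    simp only [List.nodup_cons, List.mem_cons, List.not_mem_nil, or_false, not_or,
      not_false_eq_true, List.nodup_nil, and_true]
    split_ands <;> grind
  have hda : d ≠ a := by grind
  by_cases hcd : c = d
  · subst hcd
    obtain ⟨v, hva, hcv, hc⟩ := exists_other_neighbor hH hac.symm
    have hvb : v = b := by grind
    subst hvb
    obtain ⟨x, hx⟩ := exists_not_mem_of_length_lt [u, a, c, v] (by simp [hV])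
    simp only [List.mem_cons, List.not_mem_nil, not_or] at hx
    obtain ⟨y, z, hzy, hxy, hxz, hxn⟩ := exists_two_neighbors hH x
    obtain ⟨w, hwx, hyw, hy⟩ := exists_other_neighbor hH hxy.symm
    have hy3 : y ≠ u ∧ y ≠ a ∧ y ≠ c ∧ y ≠ v ∧ y ≠ x := by grind
    have hz3 : z ≠ u ∧ z ≠ a ∧ z ≠ c ∧ z ≠ v ∧ z ≠ x := by grind
    have hw3 : w ≠ u ∧ w ≠ a ∧ w ≠ c ∧ w ≠ v ∧ w ≠ y := by grind
    have hwz : w = z := by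
      by_contra hne
      refine not_nodup_of_eight_le hV (l := [u, a, c, v, x, y, z, w]) (by simp) ?_
      simp only [List.nodup_cons, List.mem_cons, List.not_mem_nil, or_false, not_or,
        not_false_eq_true, List.nodup_nil, and_true]
      split_ands <;> grind
    subst hwz
    obtain ⟨r, hrx, hwr, hw⟩ := exists_other_neighbor hH hxz.symm
    have hry : r = y := by grind
    subst hry
    refine Or.inl (exists_embedding_C3C4 (u := x) (a := r) (b := w) (x := u) (y := a) (w := c)
      (z := v) ?_ hxn hy hw hu ha hc hb)
    simp only [List.nodup_cons, List.mem_cons, List.not_mem_nil, or_false, not_or,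
      not_false_eq_true, List.nodup_nil, and_true]
    split_ands <;> grind
  · obtain ⟨e, hea, hce, hc⟩ := exists_other_neighbor hH hac.symm
    obtain ⟨g, hgb, hdg, hd⟩ := exists_other_neighbor hH hbd.symm
    have he3 : e ≠ u ∧ e ≠ b ∧ e ≠ c := by grind
    have hg3 : g ≠ u ∧ g ≠ a ∧ g ≠ d := by grind
    have hed : e ≠ d := by
      rintro rfl
      obtain ⟨x, hx⟩ := exists_not_mem_of_length_lt [u, a, b, c, e] (by simp [hV])
      simp only [List.mem_cons, List.not_mem_nil, not_or] at hx
      obtain ⟨y, z, hzy, hxy, hxz, hxn⟩ := exists_two_neighbors hH x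
      refine not_nodup_of_eight_le hV (l := [u, a, b, c, e, x, y, z]) (by simp) ?_
      simp only [List.nodup_cons, List.mem_cons, List.not_mem_nil, or_false, not_or,
        not_false_eq_true, List.nodup_nil, and_true]
      split_ands <;> grind
    have hgc : g ≠ c := by grind
    obtain ⟨h, hhc, heh, he⟩ := exists_other_neighbor hH hce.symm
    have hh3 : h ≠ u ∧ h ≠ a ∧ h ≠ b ∧ h ≠ e := by grind
    have hge : g ≠ e := by
      rintro rfl
      obtain ⟨x, hx⟩ := exists_not_mem_of_length_lt [u, a, b, c, d, g] (by simp [hV])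
      simp only [List.mem_cons, List.not_mem_nil, not_or] at hx
      obtain ⟨y, z, hzy, hxy, hxz, hxn⟩ := exists_two_neighbors hH x
      refine not_nodup_of_eight_le hV (l := [u, a, b, c, d, g, x, y]) (by simp) ?_
      simp only [List.nodup_cons, List.mem_cons, List.not_mem_nil, or_false, not_or,
        not_false_eq_true, List.nodup_nil, and_true]
      split_ands <;> grind
    have hhd : h ≠ d := by grind
    have hhg : h = g := by
      by_contra hne
      refine not_nodup_of_eight_le hV (l := [u, a, b, c, d, e, g, h]) (by simp) ?_
      simp only [List.nodup_cons, List.mem_cons, List.not_mem_nil, or_false, not_or,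
        not_false_eq_true, List.nodup_nil, and_true]
      split_ands <;> grind
    subst hhg
    obtain ⟨r, hrd, hhr, hh⟩ := exists_other_neighbor hH hdg.symm
    have hre : r = e := by grind
    subst hre
    refine Or.inr (exists_embedding_C7 ?_ hu ha hc he hh hd hb)
    simp only [List.nodup_cons, List.mem_cons, List.not_mem_nil, or_false, not_or,
      not_false_eq_true, List.nodup_nil, and_true]
    split_ands <;> grind

/-- A `4`-regular graph on seven vertices whose matching polynomial vanishes at `1` is
`K₇ ∖ (E(C₃) ∪ E(C₄))`: the other candidate, the complement of `C₇`, has no zero at `1`. -/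
theorem nonempty_iso_K7MinusC3C4 [Fintype V] {G : SimpleGraph V} (hV : Fintype.card V = 7)
    (hreg : ∀ u, (Finset.univ.filter (G.Adj u)).card = 4)
    (h1 : aeval (1 : ℤ) (G.matchPolyOn Finset.univ) = 0) : Nonempty (G ≃g K7MinusC3C4) := by
  obtain ⟨H, hHG⟩ : ∃ H, H = Gᶜ := ⟨_, rfl⟩
  have hH : ∀ u, (Finset.univ.filter (H.Adj u)).card = 2 := by
    intro u
    have h2 : Finset.univ.filter (H.Adj u) = (Finset.univ.filter (G.Adj u))ᶜ.erase u := by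
      ext v
      simp [hHG, compl_adj, eq_comm]
    rw [h2, Finset.card_erase_of_mem (by simp), Finset.card_compl, hV, hreg]
  rcases two_regular_seven hV hH with ⟨f, hf, hadj⟩ | ⟨f, hf, hadj⟩ <;> subst hHG
  · exact nonempty_iso_of_compl_adj ((Fintype.bijective_iff_injective_and_card f).2
      ⟨hf, by simp [hV]⟩) hadj K7MinusC3C4_compl_adj
  · obtain ⟨φ⟩ := nonempty_iso_of_compl_adj (H := (cycleGraph 7)ᶜ)
      ((Fintype.bijective_iff_injective_and_card f).2 ⟨hf, by simp [hV]⟩) hadj (by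
        rw [compl_compl]
        decide)
    have h2 := matchPolyOn_map φ.toEmbedding Finset.univ
    rw [Finset.map_univ_of_surjective φ.surjective] at h2
    exact absurd (h2 ▸ h1) aeval_one_compl_cycleGraph_seven

theorem nonempty_iso_of_connected [Fintype V] {G : SimpleGraph V} (hconn : G.Connected)
    {k : ℕ} (hk : 2 ≤ k) (hreg : ∀ u, (Finset.univ.filter (G.Adj u)).card = k)
    (hG : G.IsMatchingIntegral) : Nonempty (G ≃g K7MinusC3C4) := by
  obtain ⟨h1, ⟨rfl, hV⟩ | ⟨hkV, hk'⟩⟩ := isRoot_one_and_card_of_connected hconn hk hreg hG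
  · exact nonempty_iso_K7MinusC3C4 hV hreg h1
  · have hcomplete : ∀ u v, u ≠ v → G.Adj u v := by
      intro u v huv
      have : Finset.univ.filter (G.Adj u) = Finset.univ.erase u := by
        refine Finset.eq_of_subset_of_card_le (fun w hw => ?_) ?_
        · have hw : G.Adj u w := by simpa using hw
          simp [hw.ne']
        · rw [hreg, Finset.card_erase_of_mem (Finset.mem_univ u), Finset.card_univ]
          omega
      have hv : v ∈ Finset.univ.filter (G.Adj u) := by
        rw [this]
        simp [huv.symm]
      simpa using hv
    rw [aeval_one_matchPolyOn_of_complete G hcomplete, Finset.card_univ, ← hkV] at h1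
    rcases hk' with rfl | rfl | rfl <;> exact absurd h1 (by decide)

end SimpleGraph

/-! ### Reduction to connected components -/

namespace SimpleGraph

open Polynomial
open scoped Classical

variable {V : Type*}

theorem IsMatchingIntegral.induce [Fintype V] {G : SimpleGraph V} (hG : G.IsMatchingIntegral)
    {s : Set V} (hs : ∀ u ∈ s, ∀ v, G.Adj u v → v ∈ s) [Fintype s] :
    (G.induce s).IsMatchingIntegral := by
  intro z hz
  refine hG z ?_
  rw [matchingPolynomial_eq_matchPolyOn_univ,
    ← matchPolyOn_map (Embedding.induce (G := G) s)] at hz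
  have hmem : ∀ v, v ∈ (Finset.univ : Finset s).map (Embedding.induce (G := G) s).toEmbedding ↔
      v ∈ s := fun v => by simp
  set S := (Finset.univ : Finset s).map (Embedding.induce (G := G) s).toEmbedding
  have hun : G.matchPolyOn Finset.univ = G.matchPolyOn S * G.matchPolyOn Sᶜ := by
    rw [← Finset.union_compl S]
    refine matchPolyOn_union G disjoint_compl_right fun u hu v hv huv => ?_
    exact (Finset.mem_compl.1 hv) ((hmem v).2 (hs u ((hmem u).1 hu) v huv))
  rw [matchingPolynomial_eq_matchPolyOn_univ, hun, map_mul, hz, zero_mul]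

theorem card_filter_adj_induce [Fintype V] {G : SimpleGraph V} {s : Set V}
    (hs : ∀ u ∈ s, ∀ v, G.Adj u v → v ∈ s) [Fintype s] (u : s) :
    (Finset.univ.filter ((G.induce s).Adj u)).card = (Finset.univ.filter (G.Adj u)).card := by
  rw [← Finset.card_map (Function.Embedding.subtype (· ∈ s))]
  congr 1
  ext v
  simp only [Finset.mem_map, Finset.mem_filter, Finset.mem_univ, true_and, comap_adj,
    Function.Embedding.subtype_apply]
  exact ⟨fun ⟨w, hw, h⟩ => h ▸ hw, fun h => ⟨⟨v, hs u u.2 v h⟩, h, rfl⟩⟩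

theorem exists_iso_disjointCopies [Fintype V] {W : Type*} {G : SimpleGraph V} {H : SimpleGraph W}
    (h : ∀ C : G.ConnectedComponent, Nonempty (G.induce C.supp ≃g H)) :
    ∃ m : ℕ, Nonempty (G ≃g disjointCopies m H) := by
  let φ := fun C => (h C).some
  have hφ : ∀ (a : V) (C : G.ConnectedComponent) (ha : G.connectedComponentMk a = C),
      φ (G.connectedComponentMk a) ⟨a, rfl⟩ = φ C ⟨a, ha⟩ := by
    rintro a C rfl
    rfl
  let e := Fintype.equivFin G.ConnectedComponent
  refine ⟨Fintype.card G.ConnectedComponent,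
    ⟨(Equiv.sigmaFiberEquiv G.connectedComponentMk).symm.trans
      ((Equiv.sigmaCongrRight fun C => (φ C).toEquiv).trans
        ((Equiv.sigmaEquivProd _ _).trans (Equiv.prodCongr e (Equiv.refl W)))), fun {a b} => ?_⟩⟩
  change e (G.connectedComponentMk a) = e (G.connectedComponentMk b) ∧
    H.Adj (φ (G.connectedComponentMk a) ⟨a, rfl⟩) (φ (G.connectedComponentMk b) ⟨b, rfl⟩) ↔
    G.Adj a b
  rw [e.injective.eq_iff]
  constructor
  · rintro ⟨hab, hadj⟩
    rw [hφ a _ hab, (φ _).map_adj_iff] at hadj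
    exact hadj
  · intro hadj
    have hab := ConnectedComponent.connectedComponentMk_eq_of_adj hadj
    refine ⟨hab, ?_⟩
    rw [hφ a _ hab, (φ _).map_adj_iff]
    exact hadj

end SimpleGraph

theorem mainTheorem2 {V : Type*} [Fintype V] (G : SimpleGraph V) [G.LocallyFinite]
    (k : ℕ) (hk : 2 ≤ k) (hreg : G.IsRegularOfDegree k) (hG : G.IsMatchingIntegral) :
    ∃ m : ℕ, Nonempty (G ≃g SimpleGraph.disjointCopies m SimpleGraph.K7MinusC3C4) := by
  classical
  refine SimpleGraph.exists_iso_disjointCopies fun C => ?_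
  have hs : ∀ u ∈ C.supp, ∀ v, G.Adj u v → v ∈ C.supp := fun u hu v huv =>
    (C.mem_supp_congr_adj huv).1 hu
  refine SimpleGraph.nonempty_iso_of_connected C.connected_toSimpleGraph hk (fun u => ?_)
    (hG.induce hs)
  rw [← hreg u, ← SimpleGraph.card_neighborFinset_eq_degree]
  refine Eq.trans ?_ ((SimpleGraph.card_filter_adj_induce hs u).trans ?_)
  · congr
  · congr 1
    ext v
    simp
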